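/- Let $w_1,\dots,w_n\ge 1$ and $d\ge 0$ be integers, put $|\alpha|=\sum_i w_i\alpha_i$ for $\alpha\in\mathbb N^n$, and let $f_0\in\mathbb C[x_1,\dots,x_n]$ be quasihomogeneous of type $(d;w_1,\dots,w_n)$ (every monomial $x^\alpha$ of $f_0$ has $|\alpha|=d$) with an isolated singularity at $0$. Let $x^\alpha$, $\alpha\in B$, be a monomial $\mathbb C$-basis of the Milnor algebra $\mathbb C\{x\}/(\partial f_0/\partial x_1,\dots,\partial f_0/\partial x_n)$ and let $m_1,\dots,m_k$ be the distinct monomials $x^\alpha$ with $\alpha\in B$, $|\alpha|>d$, in any order. Put $A_-=\mathbb C[t_1,\dots,t_k]$ and $F=f_0+\sum_{j=1}^k t_jm_j$, and let $A_-\{x\}$ be the ring of power series $\sum_\alpha a_\alpha(t)x^\alpha$ with coefficients $a_\alpha\in A_-$ that converge in a neighbourhood of $\{0\}\times\mathbb C^k$ in $\mathbb C^n\times\mathbb C^k$. Give $x_i$ the weight $w_i$ and $t_j$ the weight $d-\deg m_j<0$. Let $$I=A_-\{x\}\big/\Big(\tfrac{\partial F}{\partial x_1},\dots,\tfrac{\partial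 F}{\partial x_n}\Big)$$ be the relative Milnor algebra, and let $\mathcal L$ be the kernel of the Kodaira–Spencer map $$\rho:\operatorname{Der}_{\mathbb C}A_-\to (x)A_-\{x\}\Big/\Big((F)+(x)\big(\tfrac{\partial F}{\partial x_1},\dots,\tfrac{\partial F}{\partial x_n}\big)\Big),\qquad \rho(\delta)=\text{class of }\delta F=\sum_{j=1}^k\delta(t_j)m_j .$$ Then there are non-zero homogeneous elements $n_1,\dots,n_k\in A_-\{x\}$ such that each $n_iF$ has in $I$ a unique expression $n_iF=\sum_{j=1}^k h_{ij}m_j$ with $h_{ij}\in A_-$, and such that: 1. $h_{ij}=h_{k-j+1,\,k-i+1}$ for all $1\le i,j\le k$; 2. the vector fields $\delta_i=\sum_{j=1}^k h_{ij}\,\frac{\partial}{\partial t_j}$ are homogeneous of degree $\deg(n_i)$ (that is, $\delta_i$ maps homogeneous polynomials of degree $a$ to homogeneous polynomials of degree $a+\deg(n_i)$), and $\mathcal L=\sum_{i=1}^k A_-\delta_i$. -/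

import Mathlib

open scoped Topology

noncomputable section

namespace SemiQH

/-! ### Convergent power series -/

/-- Cauchy-type bound for the coefficients of a power series in `x₁, …, xₙ`. -/
def CoeffBound {n : ℕ} (r C : ℝ) (g : MvPowerSeries (Fin n) ℂ) : Prop :=
  ∀ α : Fin n →₀ ℕ, ‖MvPowerSeries.coeff α g‖ * r ^ α.degree ≤ C

theorem CoeffBound.nonneg {n : ℕ} {r C : ℝ} {g : MvPowerSeries (Fin n) ℂ}
    (h : CoeffBound r C g) : 0 ≤ C := by
  have h0 := h 0
  simp only [map_zero, pow_zero, mul_one] at h0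
  exact (norm_nonneg _).trans h0

theorem CoeffBound.mono {n : ℕ} {r s C : ℝ} {g : MvPowerSeries (Fin n) ℂ}
    (h : CoeffBound r C g) (hs : 0 ≤ s) (hsr : s ≤ r) : CoeffBound s C g := fun α =>
  (mul_le_mul_of_nonneg_left (pow_le_pow_left₀ hs hsr _) (norm_nonneg _)).trans (h α)

theorem CoeffBound.add {n : ℕ} {r C D : ℝ} {g h : MvPowerSeries (Fin n) ℂ} (hr : 0 < r)
    (hg : CoeffBound r C g) (hh : CoeffBound r D h) : CoeffBound r (C + D) (g + h) := by
  intro α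
  rw [map_add]
  calc ‖MvPowerSeries.coeff α g + MvPowerSeries.coeff α h‖ * r ^ α.degree
      ≤ (‖MvPowerSeries.coeff α g‖ + ‖MvPowerSeries.coeff α h‖) * r ^ α.degree :=
        mul_le_mul_of_nonneg_right (norm_add_le _ _) (by positivity)
    _ ≤ C + D := by rw [add_mul]; exact add_le_add (hg α) (hh α)

theorem card_antidiagonal_le {n : ℕ} (α : Fin n →₀ ℕ) :
    (Finset.HasAntidiagonal.antidiagonal α).card ≤ 2 ^ α.degree := by
  classical
  have h1 : (Finset.HasAntidiagonal.antidiagonal α).card ≤ (Finset.Iic α).card := by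
    refine Finset.card_le_card_of_injOn Prod.fst ?_ ?_
    · intro p hp
      have hp' := Finset.HasAntidiagonal.mem_antidiagonal.1 (Finset.mem_coe.1 hp)
      rw [Finset.mem_coe, Finset.mem_Iic, ← hp']
      exact le_self_add
    · intro p hp q hq hpq
      have hp' := Finset.HasAntidiagonal.mem_antidiagonal.1 (Finset.mem_coe.1 hp)
      have hq' := Finset.HasAntidiagonal.mem_antidiagonal.1 (Finset.mem_coe.1 hq)
      refine Prod.ext hpq ?_
      have : p.1 + p.2 = p.1 + q.2 := by rw [hp', hpq, hq']
      exact add_left_cancel this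
  refine h1.trans ?_
  rw [Finsupp.card_Iic, Finsupp.degree_apply, ← Finset.prod_pow_eq_pow_sum]
  refine Finset.prod_le_prod' fun i _ => ?_
  rw [Nat.card_Iic]
  exact Nat.lt_two_pow_self

theorem CoeffBound.mul {n : ℕ} {r C D : ℝ} {g h : MvPowerSeries (Fin n) ℂ} (hr : 0 < r)
    (hg : CoeffBound r C g) (hh : CoeffBound r D h) : CoeffBound (r / 2) (C * D) (g * h) := by
  classical
  intro α
  rw [MvPowerSeries.coeff_mul]
  have hC := hg.nonneg
  have hD := hh.nonneg
  have key : ‖∑ p ∈ Finset.HasAntidiagonal.antidiagonal α, MvPowerSeries.coeff p.1 g * MvPowerSeries.coeff p.2 h‖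
      * r ^ α.degree ≤ 2 ^ α.degree * (C * D) := by
    calc _ ≤ (∑ p ∈ Finset.HasAntidiagonal.antidiagonal α,
            ‖MvPowerSeries.coeff p.1 g * MvPowerSeries.coeff p.2 h‖) * r ^ α.degree :=
          mul_le_mul_of_nonneg_right (norm_sum_le _ _) (by positivity)
      _ = ∑ p ∈ Finset.HasAntidiagonal.antidiagonal α,
            ‖MvPowerSeries.coeff p.1 g * MvPowerSeries.coeff p.2 h‖ * r ^ α.degree := by
          rw [Finset.sum_mul]
      _ ≤ ∑ p ∈ Finset.HasAntidiagonal.antidiagonal α, C * D := by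
          refine Finset.sum_le_sum fun p hp => ?_
          rw [← Finset.HasAntidiagonal.mem_antidiagonal.1 hp, map_add, pow_add, norm_mul, mul_mul_mul_comm]
          exact mul_le_mul (hg _) (hh _) (by positivity) hC
      _ = ((Finset.HasAntidiagonal.antidiagonal α).card : ℝ) * (C * D) := by
          rw [Finset.sum_const, nsmul_eq_mul]
      _ ≤ 2 ^ α.degree * (C * D) := by
          refine mul_le_mul_of_nonneg_right ?_ (mul_nonneg hC hD)
          exact_mod_cast card_antidiagonal_le α
  rw [div_pow, ← mul_div_assoc, div_le_iff₀ (by positivity), mul_comm (C * D)]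
  exact key

theorem coeffBound_C {n : ℕ} (r : ℝ) (c : ℂ) :
    CoeffBound r ‖c‖ (MvPowerSeries.C (σ := Fin n) c) := by
  classical
  intro α
  rw [MvPowerSeries.coeff_C]
  split_ifs with h
  · simp [h]
  · simp

theorem coeffBound_X {n : ℕ} (i : Fin n) :
    CoeffBound 1 1 (MvPowerSeries.X i : MvPowerSeries (Fin n) ℂ) := by
  classical
  intro α
  rw [MvPowerSeries.coeff_X]
  split_ifs <;> simp

/-- The ring `ℂ{x₁, …, xₙ}` of power series that converge in some neighbourhood of `0`. -/
def ConvSeries (n : ℕ) : Subalgebra ℂ (MvPowerSeries (Fin n) ℂ) where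
  carrier := {g | ∃ r > 0, ∃ C : ℝ, CoeffBound r C g}
  mul_mem' := by
    rintro g h ⟨r, hr, C, hg⟩ ⟨s, hs, D, hh⟩
    exact ⟨min r s / 2, by positivity, C * D,
      CoeffBound.mul (by positivity) (hg.mono (by positivity) (min_le_left _ _))
        (hh.mono (by positivity) (min_le_right _ _))⟩
  add_mem' := by
    rintro g h ⟨r, hr, C, hg⟩ ⟨s, hs, D, hh⟩
    exact ⟨min r s, by positivity, C + D,
      CoeffBound.add (by positivity) (hg.mono (by positivity) (min_le_left _ _))
        (hh.mono (by positivity) (min_le_right _ _))⟩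
  algebraMap_mem' := fun c => ⟨1, one_pos, ‖c‖, coeffBound_C 1 c⟩

/-- The coordinate ring `A₋ = ℂ[t₁, …, t_k]` of the base `T₋ = ℂᵏ`. -/
abbrev Base (k : ℕ) : Type := MvPolynomial (Fin k) ℂ

theorem exists_eval_bound {k : ℕ} (p : Base k) (R : ℝ) :
    ∃ C : ℝ, ∀ t : Fin k → ℂ, (∀ j, ‖t j‖ ≤ R) → ‖MvPolynomial.eval t p‖ ≤ C := by
  have hK : IsCompact (Set.pi Set.univ fun _ : Fin k => Metric.closedBall (0 : ℂ) R) :=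
    isCompact_univ_pi fun _ => isCompact_closedBall 0 R
  obtain ⟨C, hC⟩ := hK.exists_bound_of_continuousOn
    (f := fun t => MvPolynomial.eval t p) (MvPolynomial.continuous_eval p).continuousOn
  exact ⟨C, fun t ht => hC t fun j _ => by simpa using ht j⟩

/-- The ring `A₋{x}`: power series `∑ a_α(t) x^α` with polynomial coefficients `a_α ∈ A₋` that
converge in a neighbourhood of `{0} × T₋` in `ℂⁿ × T₋`, i.e. on every bounded polydisc in `t`
they satisfy a uniform bound `|a_α(t)| ≤ C r^{-|α|}` with some `r > 0`. -/
def relSubalgebra (n k : ℕ) : Subalgebra (Base k) (MvPowerSeries (Fin n) (Base k)) where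
  carrier := {g | ∀ R : ℝ, ∃ r > 0, ∃ C : ℝ, ∀ t : Fin k → ℂ, (∀ j, ‖t j‖ ≤ R) →
    CoeffBound r C (MvPowerSeries.map (MvPolynomial.eval t) g)}
  mul_mem' := by
    intro g h hg hh R
    obtain ⟨r, hr, C, hg⟩ := hg R
    obtain ⟨s, hs, D, hh⟩ := hh R
    refine ⟨min r s / 2, by positivity, C * D, fun t ht => ?_⟩
    rw [map_mul]
    exact CoeffBound.mul (by positivity) ((hg t ht).mono (by positivity) (min_le_left _ _))
        ((hh t ht).mono (by positivity) (min_le_right _ _))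
  add_mem' := by
    intro g h hg hh R
    obtain ⟨r, hr, C, hg⟩ := hg R
    obtain ⟨s, hs, D, hh⟩ := hh R
    refine ⟨min r s, by positivity, C + D, fun t ht => ?_⟩
    rw [map_add]
    exact CoeffBound.add (by positivity) ((hg t ht).mono (by positivity) (min_le_left _ _))
        ((hh t ht).mono (by positivity) (min_le_right _ _))
  algebraMap_mem' := by
    intro p R
    obtain ⟨C, hC⟩ := exists_eval_bound p R
    refine ⟨1, one_pos, C, fun t ht α => ?_⟩
    have h1 : MvPowerSeries.map (MvPolynomial.eval t)
        (algebraMap (Base k) (MvPowerSeries (Fin n) (Base k)) p)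
        = MvPowerSeries.C (MvPolynomial.eval t p) := by
      rw [← MvPowerSeries.c_eq_algebraMap, MvPowerSeries.map_C]
    rw [h1]
    exact (coeffBound_C 1 _ α).trans (hC t ht)

/-- `A₋{x}` as a type. -/
def RelSeries (n k : ℕ) : Type := relSubalgebra n k

instance (n k : ℕ) : CommRing (RelSeries n k) := inferInstanceAs (CommRing (relSubalgebra n k))

instance (n k : ℕ) : Algebra (Base k) (RelSeries n k) :=
  inferInstanceAs (Algebra (Base k) (relSubalgebra n k))

/-- The inclusion `A₋{x} → A₋[[x]]`. -/
def toSeries (n k : ℕ) : RelSeries n k →ₐ[Base k] MvPowerSeries (Fin n) (Base k) :=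
  (relSubalgebra n k).val

/-- The inclusion `ℂ[x] → ℂ{x}`. -/
def polyToConv (n : ℕ) : MvPolynomial (Fin n) ℂ →ₐ[ℂ] ConvSeries n :=
  MvPolynomial.aeval fun i => ⟨MvPowerSeries.X i, 1, one_pos, 1, coeffBound_X i⟩

theorem coe_polyToConv {n : ℕ} (p : MvPolynomial (Fin n) ℂ) :
    (polyToConv n p : MvPowerSeries (Fin n) ℂ) = (p : MvPowerSeries (Fin n) ℂ) := by
  have h : (ConvSeries n).val.comp (polyToConv n) =
      MvPolynomial.coeToMvPowerSeries.algHom ℂ := by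
    ext i : 1
    simp [polyToConv]
  simpa using DFunLike.congr_fun h p

theorem X_mem_relSubalgebra {n k : ℕ} (i : Fin n) :
    (MvPowerSeries.X i : MvPowerSeries (Fin n) (Base k)) ∈ relSubalgebra n k :=
  fun _ => ⟨1, one_pos, 1, fun t _ => by rw [MvPowerSeries.map_X]; exact coeffBound_X i⟩

/-- The variable `x_i` as an element of `A₋{x}`. -/
def relVar (n k : ℕ) (i : Fin n) : RelSeries n k :=
  (⟨MvPowerSeries.X i, X_mem_relSubalgebra i⟩ : relSubalgebra n k)

/-- The inclusion `A₋[x] → A₋{x}`. -/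
def polyToRel (n k : ℕ) : MvPolynomial (Fin n) (Base k) →ₐ[Base k] RelSeries n k :=
  MvPolynomial.aeval (relVar n k)

theorem coe_polyToRel {n k : ℕ} (p : MvPolynomial (Fin n) (Base k)) :
    toSeries n k (polyToRel n k p) =
      (p : MvPowerSeries (Fin n) (Base k)) := by
  have h : (toSeries n k).comp (polyToRel n k) =
      MvPolynomial.coeToMvPowerSeries.algHom (Base k) := by
    ext i : 1
    rw [AlgHom.comp_apply, polyToRel, MvPolynomial.aeval_X]
    rw [show toSeries n k (relVar n k i) = MvPowerSeries.X i from rfl]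
    simp
  simpa using DFunLike.congr_fun h p

/-! ### Isolated singularities, the Milnor algebra, upper monomials -/

/-- The hypersurface `f = 0` is singular at `0`, and at no other point of a neighbourhood. -/
def HasIsolatedSingularity {n : ℕ} (f : MvPolynomial (Fin n) ℂ) : Prop :=
  (MvPolynomial.eval 0 f = 0 ∧ ∀ i, MvPolynomial.eval 0 (MvPolynomial.pderiv i f) = 0) ∧
  ∀ᶠ x in 𝓝[≠] (0 : Fin n → ℂ),
    ¬ (MvPolynomial.eval x f = 0 ∧ ∀ i, MvPolynomial.eval x (MvPolynomial.pderiv i f) = 0)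

/-- The Milnor algebra `ℂ{x} / (∂f/∂x₁, …, ∂f/∂xₙ)`. -/
abbrev MilnorAlgebra {n : ℕ} (f : MvPolynomial (Fin n) ℂ) : Type :=
  ConvSeries n ⧸ Ideal.span (Set.range fun i => polyToConv n (MvPolynomial.pderiv i f))

/-- The class of the monomial `x^α` in the Milnor algebra. -/
def milnorMonomial {n : ℕ} (f : MvPolynomial (Fin n) ℂ) (α : Fin n →₀ ℕ) : MilnorAlgebra f :=
  Ideal.Quotient.mk _ (polyToConv n (MvPolynomial.monomial α 1))

/-- The monomials `x^α`, `α ∈ B`, form a `ℂ`-basis of the Milnor algebra of `f`. -/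
def IsMonomialBasis {n : ℕ} (f : MvPolynomial (Fin n) ℂ) (B : Set (Fin n →₀ ℕ)) : Prop :=
  LinearIndependent ℂ (fun α : B => milnorMonomial f α) ∧
  Submodule.span ℂ (milnorMonomial f '' B) = ⊤

/-- `m₁, …, m_k` is an enumeration without repetition of (the exponents of) the upper monomials
`x^α`, `α ∈ B`, of weighted degree `> d`. -/
structure EnumeratesUpper {n k : ℕ} (w : Fin n → ℕ) (d : ℕ) (B : Set (Fin n →₀ ℕ))
    (m : Fin k → (Fin n →₀ ℕ)) : Prop where
  injective : Function.Injective m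
  range_eq : Set.range m = {α | α ∈ B ∧ d < Finsupp.weight w α}

theorem EnumeratesUpper.ne_zero {n k : ℕ} {w : Fin n → ℕ} {d : ℕ} {B : Set (Fin n →₀ ℕ)}
    {m : Fin k → (Fin n →₀ ℕ)} (h : EnumeratesUpper w d B m) (j : Fin k) : m j ≠ 0 := by
  intro h0
  have hj : m j ∈ {α | α ∈ B ∧ d < Finsupp.weight w α} := h.range_eq ▸ Set.mem_range_self j
  have := hj.2
  rw [h0, map_zero] at this
  exact Nat.not_lt_zero _ this

/-! ### The unfolding `F`, the relative Milnor algebra and the Kodaira–Spencer map -/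

section Family

variable {n k : ℕ} (f₀ : MvPolynomial (Fin n) ℂ) (m : Fin k → (Fin n →₀ ℕ))

/-- `F(x,t) = f₀(x) + ∑ t_j m_j(x)` as an element of `A₋[x]`. -/
def unfoldingPoly : MvPolynomial (Fin n) (Base k) :=
  MvPolynomial.map MvPolynomial.C f₀ +
    ∑ j, MvPolynomial.monomial (m j) (MvPolynomial.X j : Base k)

/-- `F` as an element of `A₋{x}`. -/
def unfolding : RelSeries n k := polyToRel n k (unfoldingPoly f₀ m)

/-- The monomial `m_j` as an element of `A₋{x}`. -/
def upperMonomial (j : Fin k) : RelSeries n k :=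
  polyToRel n k (MvPolynomial.monomial (m j) 1)

/-- The ideal `(∂F/∂x₁, …, ∂F/∂xₙ)` of `A₋{x}`. -/
def relJacobian : Ideal (RelSeries n k) :=
  Ideal.span (Set.range fun i => polyToRel n k (MvPolynomial.pderiv i (unfoldingPoly f₀ m)))

/-- The relative Milnor algebra `I = A₋{x} / (∂F/∂x₁, …, ∂F/∂xₙ)`. -/
abbrev RelMilnorAlgebra : Type := RelSeries n k ⧸ relJacobian f₀ m

/-- The ideal `(x) = (x₁, …, xₙ)` of `A₋{x}`. -/
def xIdeal (n k : ℕ) : Ideal (RelSeries n k) :=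
  Ideal.span (Set.range fun i => polyToRel n k (MvPolynomial.X i))

/-- The ideal `(F) + (x) (∂F/∂x₁, …, ∂F/∂xₙ)` of `A₋{x}`. -/
def ksIdeal : Ideal (RelSeries n k) :=
  Ideal.span {unfolding f₀ m} ⊔ xIdeal n k * relJacobian f₀ m

/-- The `A₋`-module `(x)A₋{x} / ((F) + (x) (∂F/∂x₁, …, ∂F/∂xₙ))`. -/
abbrev KSTarget : Type :=
  ↥(xIdeal n k) ⧸ Submodule.comap (xIdeal n k).subtype (ksIdeal f₀ m)

/-- `δF = ∑ δ(t_j) m_j` for a vector field `δ ∈ Der_ℂ A₋`. -/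
def derivUnfolding : Derivation ℂ (Base k) (Base k) →ₗ[Base k] RelSeries n k where
  toFun δ := ∑ j, δ (MvPolynomial.X j) • upperMonomial m j
  map_add' := by
    intro δ δ'
    simp only [Derivation.add_apply, add_smul, Finset.sum_add_distrib]
  map_smul' := by
    intro a δ
    simp only [Derivation.smul_apply, smul_eq_mul, mul_smul, Finset.smul_sum, RingHom.id_apply]

/-- `derivUnfolding m δ` is obtained by applying `δ` to the coefficients of `F`. -/
theorem coeff_derivUnfolding (δ : Derivation ℂ (Base k) (Base k)) (α : Fin n →₀ ℕ) :
    MvPowerSeries.coeff α (toSeries n k (derivUnfolding m δ)) =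
      δ (MvPowerSeries.coeff α (toSeries n k (unfolding f₀ m))) := by
  classical
  have h1 : (toSeries n k (derivUnfolding m δ)) =
      ((∑ j, δ (MvPolynomial.X j) • MvPolynomial.monomial (m j) (1 : Base k) :
        MvPolynomial (Fin n) (Base k)) : MvPowerSeries (Fin n) (Base k)) := by
    rw [← coe_polyToRel, map_sum]
    simp only [map_smul]
    rfl
  rw [h1, unfolding, coe_polyToRel, MvPolynomial.coeff_coe, MvPolynomial.coeff_coe, unfoldingPoly,
    MvPolynomial.coeff_add, MvPolynomial.coeff_map, map_add, MvPolynomial.coeff_sum,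
    MvPolynomial.coeff_sum, map_sum]
  have h2 : δ (MvPolynomial.C (MvPolynomial.coeff α f₀)) = 0 := by
    rw [← MvPolynomial.algebraMap_eq]
    exact δ.map_algebraMap _
  rw [h2, zero_add]
  refine Finset.sum_congr rfl fun j _ => ?_
  rw [MvPolynomial.coeff_smul, MvPolynomial.coeff_monomial, MvPolynomial.coeff_monomial]
  split_ifs <;> simp

theorem upperMonomial_mem (j : Fin k) (hj : m j ≠ 0) : upperMonomial m j ∈ xIdeal n k := by
  classical
  obtain ⟨i, hi⟩ := Finsupp.ne_iff.1 hj
  have h1 : MvPolynomial.monomial (m j) (1 : Base k) =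
      MvPolynomial.monomial (m j - Finsupp.single i 1) 1 * MvPolynomial.X i := by
    rw [MvPolynomial.X, MvPolynomial.monomial_mul, mul_one, tsub_add_cancel_of_le]
    rw [Finsupp.single_le_iff]
    exact Nat.one_le_iff_ne_zero.2 hi
  rw [upperMonomial, h1, map_mul]
  exact Ideal.mul_mem_left _ _ (Ideal.subset_span ⟨i, rfl⟩)

theorem derivUnfolding_mem (hm : ∀ j, m j ≠ 0) (δ : Derivation ℂ (Base k) (Base k)) :
    derivUnfolding m δ ∈ (xIdeal n k).restrictScalars (Base k) := by
  change ∑ j, δ (MvPolynomial.X j) • upperMonomial m j ∈ _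
  exact Submodule.sum_mem ((xIdeal n k).restrictScalars (Base k)) fun j _ =>
    Submodule.smul_mem ((xIdeal n k).restrictScalars (Base k)) _ (upperMonomial_mem m j (hm j))

/-- The Kodaira–Spencer map
`ρ : Der_ℂ A₋ → (x)A₋{x} / ((F) + (x) (∂F/∂x₁, …, ∂F/∂xₙ))`, `ρ(δ) = class(δF)`. -/
def kodairaSpencer (hm : ∀ j, m j ≠ 0) :
    Derivation ℂ (Base k) (Base k) →ₗ[Base k] KSTarget f₀ m :=
  ((Submodule.mkQ (Submodule.comap (xIdeal n k).subtype (ksIdeal f₀ m))).restrictScalars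
    (Base k)).comp
    (LinearMap.codRestrict ((xIdeal n k).restrictScalars (Base k)) (derivUnfolding m)
      (derivUnfolding_mem m hm))

/-- The equations `n_i F = ∑_j h_{ij} m_j` in `I`, for all `i`. -/
def IsCoeffMatrix (N : Fin k → RelSeries n k) (h : Fin k → Fin k → Base k) : Prop :=
  ∀ i, (Ideal.Quotient.mk (relJacobian f₀ m) (N i * unfolding f₀ m) : RelMilnorAlgebra f₀ m) =
    ∑ j, h i j • Ideal.Quotient.mk (relJacobian f₀ m) (upperMonomial m j)

end Family

/-! ### Gradings -/

/-- The weight `w(t_j) = d - deg m_j` of `t_j`. -/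
def tWeight {n k : ℕ} (w : Fin n → ℕ) (d : ℕ) (m : Fin k → (Fin n →₀ ℕ)) (j : Fin k) : ℤ :=
  (d : ℤ) - (Finsupp.weight w (m j) : ℤ)

/-- `g = ∑ a_α(t) x^α ∈ A₋{x}` is homogeneous of degree `e` in `x` and `t`: the coefficient
`a_α` is homogeneous of degree `e - |α|`. -/
def IsHomogeneousSeries {n k : ℕ} (w : Fin n → ℕ) (v : Fin k → ℤ) (g : RelSeries n k)
    (e : ℤ) : Prop :=
  ∀ α : Fin n →₀ ℕ, MvPolynomial.IsWeightedHomogeneous v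
    (MvPowerSeries.coeff α (toSeries n k g))
    (e - (Finsupp.weight w α : ℤ))

/-- The vector field `δ` is homogeneous of degree `e`: it raises degrees by `e`. -/
def IsHomogeneousField {k : ℕ} (v : Fin k → ℤ) (δ : Derivation ℂ (Base k) (Base k))
    (e : ℤ) : Prop :=
  ∀ (p : Base k) (a : ℤ), MvPolynomial.IsWeightedHomogeneous v p a →
    MvPolynomial.IsWeightedHomogeneous v (δ p) (a + e)

/-- The vector field `∑ h_j ∂/∂t_j`. -/
def vectorField {k : ℕ} (h : Fin k → Base k) : Derivation ℂ (Base k) (Base k) :=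
  ∑ j, h j • MvPolynomial.pderiv j

end SemiQH

end

open SemiQH

/-!
All `t_j` have negative weight, so dividing a polynomial by the `∂F/∂xᵢ` instead of the `∂f₀/∂xᵢ`
only adds terms of larger weight in `x`. Hence the monomials `x^β`, `β ∈ B`, span the relative
Milnor algebra `I` over `A₋`. By Wiebe's theorem the Grothendieck residue along the `∂f₀/∂xᵢ`
induces a perfect pairing on the Milnor algebra of `f₀`, and it extends to `I`; the Gram
determinant of the `x^β` is nonzero at `t = 0`, so `I` is free on them.

Being free on homogeneous elements, `I` carries a homogeneous functional `ψ` that restricts to the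
residue at `t = 0`. Its Gram determinant is homogeneous and does not vanish at `t = 0`. Since a
homogeneous polynomial in variables of negative weight with nonzero constant term is constant, the
pairing `(g, h) ↦ ψ(g h)` is perfect over `A₋` and the `x^β` have a homogeneous dual basis `N_β`.

By Euler's identity `F` agrees in `I` with a polynomial in weights greater than `d`, and division
does not lower the weight, so every multiple of `F` is in `I` a combination of the `m_j`; by duality
`N_β F = 0` unless `x^β` is one of the `m_j`. Writing `N_j` for the element dual to `m_j` and
`n_i = N_{k-i+1}`, the coefficient `h_{ij} = ψ(n_i F N_j) = ψ(N_{k-i+1} N_j F)` is symmetric about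
the antidiagonal. If `δ` is in the kernel of `ρ`, then `δF = g F` in `I` for some `g`, and expanding
`g` in the `N_β` writes `δ` through the `δ_i`. Conversely, in weights greater than `d` the quotients
of the division have no constant term in `x`, so `δ_i F` and `n_i F` agree modulo `(x) (∂F/∂xᵢ)ᵢ`.
-/

noncomputable section

namespace SemiQH

/-! ### Wiebe's theorem on determinants and regular sequences -/

section WeaklyRegular

open RingTheory.Sequence

universe u

variable {R : Type u} [CommRing R] {n : ℕ}

theorem isWeaklyRegular_ofFn_iff {a : Fin n → R} :
    IsWeaklyRegular R (List.ofFn a) ↔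
      ∀ i g, a i * g ∈ Ideal.span (a '' Set.Iio i) → g ∈ Ideal.span (a '' Set.Iio i) := by
  have htake (i : ℕ) (hi : i < n) :
      (Ideal.ofList ((List.ofFn a).take i) • ⊤ : Ideal R) =
        Ideal.span (a '' Set.Iio ⟨i, hi⟩) := by
    rw [smul_eq_mul, Ideal.mul_top, Ideal.ofList]
    congr 1
    ext x
    simp only [List.mem_take_iff_getElem, Set.mem_ofPred_eq, List.getElem_ofFn, List.length_ofFn,
      Set.mem_image, Set.mem_Iio, Fin.lt_def, lt_min_iff]
    exact ⟨fun ⟨j, hj, h⟩ => ⟨⟨j, hj.2⟩, hj.1, h⟩, fun ⟨j, hj, h⟩ => ⟨j, ⟨hj, j.2⟩, h⟩⟩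
  simp only [isWeaklyRegular_iff, List.length_ofFn, List.getElem_ofFn, Fin.forall_iff]
  refine forall₂_congr fun i hi => ?_
  rw [htake i hi, isSMulRegular_quotient_iff_mem_of_smul_mem]
  rfl

theorem span_image_Iio_succ (a : Fin (n + 1) → R) (i : Fin n) :
    Ideal.span (a '' Set.Iio i.succ) =
      Ideal.span {a i.castSucc} ⊔ Ideal.span (a '' Set.Iio i.castSucc) := by
  rw [← Ideal.span_union, Set.singleton_union, ← Set.image_insert_eq]
  congr 2
  ext j
  simp only [Set.mem_Iio, Set.mem_insert_iff, Fin.lt_def, Fin.ext_iff, Fin.val_succ,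
    Fin.val_castSucc]
  omega

/-- The half of the permutability of regular sequences that needs no finiteness. -/
theorem isSMulRegular_quotient_span_singleton_sup {I : Ideal R} {x y : R}
    (hx : IsSMulRegular (R ⧸ I) x) (hy : IsSMulRegular (R ⧸ Ideal.span {x} ⊔ I) y) :
    IsSMulRegular (R ⧸ Ideal.span {y} ⊔ I) x := by
  simp only [isSMulRegular_quotient_iff_mem_of_smul_mem, smul_eq_mul,
    Ideal.mem_span_singleton_sup] at *
  rintro g ⟨h, p, hp, hxg⟩
  obtain ⟨h', q, hq, rfl⟩ := hy h ⟨g, -p, I.neg_mem hp, by linear_combination -hxg⟩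
  refine ⟨h', g - h' * y, hx _ ?_, by ring⟩
  have : x * (g - h' * y) = p + y * q := by linear_combination -hxg
  exact this ▸ I.add_mem hp (I.mul_mem_left _ hq)

theorem isWeaklyRegular_ofFn_mk_castSucc {a : Fin (n + 1) → R}
    (ha : IsWeaklyRegular R (List.ofFn a)) {y : R}
    (hy : ∀ i, IsSMulRegular (R ⧸ Ideal.span (a '' Set.Iio i)) y) :
    IsWeaklyRegular (R ⧸ Ideal.span {y})
      (List.ofFn fun i : Fin n => Ideal.Quotient.mk (Ideal.span {y}) (a i.castSucc)) := by
  rw [isWeaklyRegular_ofFn_iff] at ha ⊢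
  intro i g hg
  obtain ⟨g, rfl⟩ := Ideal.Quotient.mk_surjective g
  have hreg : IsSMulRegular (R ⧸ Ideal.span {y} ⊔ Ideal.span (a '' Set.Iio i.castSucc))
      (a i.castSucc) :=
    isSMulRegular_quotient_span_singleton_sup
      ((isSMulRegular_quotient_iff_mem_of_smul_mem _ _).2 (ha i.castSucc))
      (span_image_Iio_succ a i ▸ hy i.succ)
  have himage : (fun i : Fin n => Ideal.Quotient.mk (Ideal.span {y}) (a i.castSucc)) '' Set.Iio i =
      Ideal.Quotient.mk (Ideal.span {y}) '' (a '' Set.Iio i.castSucc) := by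
    rw [← Fin.image_castSucc_Iio, Set.image_image, Set.image_image]
  rw [himage, ← Ideal.map_span] at hg ⊢
  rw [← map_mul, Ideal.mem_quotient_iff_mem_sup, sup_comm] at hg
  rw [Ideal.mem_quotient_iff_mem_sup, sup_comm]
  exact mem_of_isSMulRegular_quotient_of_smul_mem hreg hg

theorem det_mul_sub_adjugate_mul_mem {ι : Type*} [Fintype ι] [DecidableEq ι] (A : Matrix ι ι R)
    (b : ι → R) (i j : ι) :
    A.det * b j - A.adjugate j i * A.mulVec b i ∈ Ideal.span (A.mulVec b '' {i}ᶜ) := by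
  have hcramer : A.det * b j = ∑ l, A.adjugate j l * A.mulVec b l := by
    have := congrFun (Matrix.mulVec_mulVec b A.adjugate A) j
    rw [Matrix.adjugate_mul, Matrix.smul_mulVec, Matrix.one_mulVec] at this
    exact this.symm
  rw [hcramer, ← Finset.add_sum_erase _ _ (Finset.mem_univ i), add_sub_cancel_left]
  exact Ideal.sum_mem _ fun l hl =>
    Ideal.mul_mem_left _ _ (Ideal.subset_span ⟨l, Finset.ne_of_mem_erase hl, rfl⟩)

theorem minor_mul_mem_of_det_mul_mem {a b : Fin (n + 1) → R}
    (A : Matrix (Fin (n + 1)) (Fin (n + 1)) R) (hab : A.mulVec b = a)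
    (ha : IsWeaklyRegular R (List.ofFn a)) {z : R}
    (hz : A.det * z ∈ Ideal.span (Set.range a)) :
    (A.submatrix Fin.castSucc Fin.succ).det * z ∈
      Ideal.span {b 0} ⊔ Ideal.span (a '' Set.Iio (Fin.last n)) := by
  set I := Ideal.span (a '' Set.Iio (Fin.last n)) with hI
  set D := (A.submatrix Fin.castSucc Fin.succ).det
  have hcramer : A.det * b 0 - (-1) ^ n * D * a (Fin.last n) ∈ I := by
    have hcompl : ({Fin.last n}ᶜ : Set (Fin (n + 1))) = Set.Iio (Fin.last n) :=
      Set.ext fun i => Fin.lt_last_iff_ne_last.symm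
    have hadj : A.adjugate 0 (Fin.last n) = (-1) ^ n * D := by
      simp [Matrix.adjugate_fin_succ_eq_det_submatrix, D]
    simpa only [hab, hcompl, hadj] using det_mul_sub_adjugate_mul_mem A b (Fin.last n) 0
  obtain ⟨c, p, hp, hcp⟩ : ∃ c, ∃ p ∈ I, c * a (Fin.last n) + p = A.det * z := by
    have hrange : Set.range a = insert (a (Fin.last n)) (a '' Set.Iio (Fin.last n)) := by
      rw [← Set.image_insert_eq, Set.Iio_insert, ← Fin.top_eq_last, Set.Iic_top, Set.image_univ]
    rwa [← Ideal.mem_span_singleton_sup, hI, ← Ideal.span_union, Set.singleton_union, ← hrange]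
  have hlast : (-1) ^ n * D * z - b 0 * c ∈ I := by
    refine isWeaklyRegular_ofFn_iff.1 ha _ _ ?_
    have : a (Fin.last n) * ((-1) ^ n * D * z - b 0 * c) =
        b 0 * p - (A.det * b 0 - (-1) ^ n * D * a (Fin.last n)) * z := by
      linear_combination -(b 0) * hcp
    exact this ▸ I.sub_mem (I.mul_mem_left _ hp) (I.mul_mem_right _ hcramer)
  have hsign : ((-1 : R) ^ n) * (-1) ^ n = 1 := by rw [← mul_pow]; simp
  exact Ideal.mem_span_singleton_sup.2 ⟨(-1) ^ n * c, (-1) ^ n * ((-1) ^ n * D * z - b 0 * c),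
    I.mul_mem_left _ hlast, by linear_combination D * z * hsign⟩

/-- Modulo `b 0` the last term of `a` can be dropped, together with the last row and the first
column of `A`. -/
theorem mem_span_of_det_mul_mem_of_quotient {a b : Fin (n + 1) → R}
    (A : Matrix (Fin (n + 1)) (Fin (n + 1)) R) (hab : A.mulVec b = a)
    (ha : IsWeaklyRegular R (List.ofFn a))
    (hb : ∀ i, IsSMulRegular (R ⧸ Ideal.span (a '' Set.Iio i)) (b 0))
    (ih : ∀ (a' b' : Fin n → R ⧸ Ideal.span {b 0}) (A' : Matrix (Fin n) (Fin n) _),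
      A'.mulVec b' = a' → IsWeaklyRegular (R ⧸ Ideal.span {b 0}) (List.ofFn a') →
      ∀ z, A'.det * z ∈ Ideal.span (Set.range a') → z ∈ Ideal.span (Set.range b'))
    {z : R} (hz : A.det * z ∈ Ideal.span (Set.range a)) : z ∈ Ideal.span (Set.range b) := by
  set π := Ideal.Quotient.mk (Ideal.span {b 0})
  have hπb : π (b 0) = 0 := Ideal.Quotient.eq_zero_iff_mem.2 (Ideal.mem_span_singleton_self _)
  have hmulVec : ((A.submatrix Fin.castSucc Fin.succ).map π).mulVec (fun j => π (b j.succ)) =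
      fun i => π (a i.castSucc) := by
    ext i
    simp only [← hab, Matrix.mulVec, dotProduct, Matrix.map_apply, Matrix.submatrix_apply,
      Fin.sum_univ_succ (n := n), map_add, map_mul, hπb, mul_zero, zero_add, map_sum]
  have hminor : ((A.submatrix Fin.castSucc Fin.succ).map π).det * π z ∈
      Ideal.span (Set.range fun i : Fin n => π (a i.castSucc)) := by
    have hdet : ((A.submatrix Fin.castSucc Fin.succ).map π).det =
        π (A.submatrix Fin.castSucc Fin.succ).det := (RingHom.map_det π _).symm
    have hrange : (Set.range fun i : Fin n => π (a i.castSucc)) =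
        π '' (a '' Set.Iio (Fin.last n)) := by
      have hIio : Set.Iio (Fin.last n) = Set.range Fin.castSucc := Fin.range_castSucc.symm
      rw [hIio, ← Set.range_comp, ← Set.range_comp]
      rfl
    rw [hdet, ← map_mul, hrange, ← Ideal.map_span, Ideal.mem_quotient_iff_mem_sup, sup_comm]
    exact minor_mul_mem_of_det_mul_mem A hab ha hz
  have hmem := ih _ _ _ hmulVec (isWeaklyRegular_ofFn_mk_castSucc ha hb) (π z) hminor
  have hrange : (Set.range fun j : Fin n => π (b j.succ)) =
      π '' Set.range fun j : Fin n => b j.succ :=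
    Set.range_comp π fun j : Fin n => b j.succ
  rw [hrange, ← Ideal.map_span, Ideal.mem_quotient_iff_mem_sup] at hmem
  have hle : Ideal.span (Set.range fun j : Fin n => b j.succ) ⊔ Ideal.span {b 0} ≤
      Ideal.span (Set.range b) :=
    sup_le (Ideal.span_mono (Set.range_comp_subset_range Fin.succ b))
      (Ideal.span_mono (Set.singleton_subset_iff.2 (Set.mem_range_self 0)))
  exact hle hmem

section GenericCombination

open Polynomial

/-- The generic linear combination `∑ⱼ bⱼ Tʲ` of the entries of `b`. -/
def genericCombination (b : Fin n → R) : R[X] := ∑ j, C (b j) * X ^ (j : ℕ)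

theorem coeff_genericCombination (b : Fin n → R) (j : Fin n) :
    (genericCombination b).coeff j = b j := by
  rw [genericCombination, finsetSum_coeff, Finset.sum_eq_single j]
  · simp
  · intro i _ hij
    rw [coeff_C_mul_X_pow, if_neg (Fin.val_ne_of_ne hij.symm)]
  · simp

theorem isSMulRegular_genericCombination {I : Ideal R} {b : Fin n → R}
    (hb : ∀ r, (∀ j, r * b j ∈ I) → r ∈ I) :
    IsSMulRegular (R[X] ⧸ I.map (C : R →+* R[X])) (genericCombination b) := by
  rw [isSMulRegular_quotient_iff_mem_of_smul_mem]
  intro g hg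
  set π := Ideal.Quotient.mk I
  have hker (f : R[X]) : f ∈ I.map (C : R →+* R[X]) ↔ f.map π = 0 := by
    rw [← coe_mapRingHom, ← RingHom.mem_ker, ker_mapRingHom, Ideal.mk_ker]
  rw [hker, smul_eq_mul, Polynomial.map_mul] at hg
  rw [hker]
  have hregular : (genericCombination b).map π ∈ nonZeroDivisors (R ⧸ I)[X] := by
    -- McCoy: a polynomial is regular unless its coefficients have a common annihilator
    rw [Polynomial.mem_nonZeroDivisors_iff]
    intro r hr
    obtain ⟨r, rfl⟩ := Ideal.Quotient.mk_surjective r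
    refine Ideal.Quotient.eq_zero_iff_mem.2 (hb r fun j => Ideal.Quotient.eq_zero_iff_mem.1 ?_)
    simpa [coeff_genericCombination, π] using congrArg (Polynomial.coeff · (j : ℕ)) hr
  exact (mul_left_mem_nonZeroDivisors_eq_zero_iff hregular).1 hg

/-- The unipotent matrix that replaces the first entry of a vector by its generic combination. -/
def genericRow (R : Type u) [CommRing R] (n : ℕ) : Matrix (Fin (n + 1)) (Fin (n + 1)) R[X] :=
  Matrix.updateRow 1 0 fun j => X ^ (j : ℕ)

theorem det_genericRow : (genericRow R n).det = 1 := by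
  rw [Matrix.det_of_isUpperTriangular]
  · refine Finset.prod_eq_one fun j _ => ?_
    cases j using Fin.cases <;> simp [genericRow, Matrix.updateRow_apply]
  · intro i j hij
    have hi : i ≠ 0 := Fin.ne_zero_of_lt hij
    rw [genericRow, Matrix.updateRow_ne hi]
    exact Matrix.one_apply_ne (ne_of_gt hij)

theorem genericRow_mulVec (b : Fin (n + 1) → R) :
    (genericRow R n).mulVec (C ∘ b) =
      Function.update (C ∘ b) 0 (genericCombination b) := by
  ext1 i
  rcases eq_or_ne i 0 with rfl | hi
  · rw [Function.update_self, genericRow, Matrix.mulVec, Matrix.updateRow_self]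
    exact Finset.sum_congr rfl fun j _ => X_pow_mul_C _ _
  · rw [Function.update_of_ne hi, Matrix.mulVec, genericRow, Matrix.updateRow_ne hi]
    exact congrFun (Matrix.one_mulVec (C ∘ b)) i

theorem span_genericRow_mulVec_le (b : Fin (n + 1) → R) :
    Ideal.span (Set.range ((genericRow R n).mulVec (C ∘ b))) ≤
      (Ideal.span (Set.range b)).map (C : R →+* R[X]) := by
  rw [Ideal.span_le, Set.range_subset_iff]
  intro i
  rw [Matrix.mulVec, dotProduct]
  exact Ideal.sum_mem _ fun j _ => Ideal.mul_mem_left _ _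
    (Ideal.mem_map_of_mem C (Ideal.subset_span (Set.mem_range_self (f := b) j)))

/-- **Wiebe's theorem**. Passing to the generic combination of `b` makes its first entry regular
modulo each initial segment of `a`, so that one can divide by that entry and induct. -/
theorem mem_span_of_det_mul_mem {a b : Fin n → R} {A : Matrix (Fin n) (Fin n) R}
    (hab : A.mulVec b = a) (ha : IsWeaklyRegular R (List.ofFn a)) {z : R}
    (hz : A.det * z ∈ Ideal.span (Set.range a)) : z ∈ Ideal.span (Set.range b) := by
  induction n generalizing R with
  | zero => simpa using hz
  | succ n ih =>
    have hspan (s : Set R) : Ideal.span (C '' s) = (Ideal.span s).map (C : R →+* R[X]) :=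
      (Ideal.map_span C s).symm
    have hmulVec : (A.map C * (genericRow R n).adjugate).mulVec
        ((genericRow R n).mulVec (C ∘ b)) = C ∘ a := by
      rw [Matrix.mulVec_mulVec, Matrix.mul_assoc, Matrix.adjugate_mul, det_genericRow, one_smul,
        mul_one, ← hab]
      exact (funext (RingHom.map_mulVec C A b)).symm
    have hdet : (A.map C * (genericRow R n).adjugate).det = C A.det := by
      rw [Matrix.det_mul, Matrix.det_adjugate, det_genericRow, one_pow, mul_one, RingHom.map_det]
      rfl
    have hregular : IsWeaklyRegular R[X] (List.ofFn (C ∘ a)) := by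
      rw [isWeaklyRegular_ofFn_iff] at ha ⊢
      intro i g hg
      rw [Set.image_comp, hspan, Ideal.mem_map_C_iff] at hg ⊢
      exact fun m => ha i _ (by simpa using hg m)
    have hgeneric (i : Fin (n + 1)) : IsSMulRegular (R[X] ⧸ Ideal.span ((C ∘ a) '' Set.Iio i))
        ((genericRow R n).mulVec (C ∘ b) 0) := by
      rw [genericRow_mulVec, Function.update_self, Set.image_comp, hspan]
      refine isSMulRegular_genericCombination fun r hr => isWeaklyRegular_ofFn_iff.1 ha i r ?_
      rw [← hab, Matrix.mulVec, dotProduct, Finset.sum_mul]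
      refine Ideal.sum_mem _ fun j _ => ?_
      rw [mul_assoc, mul_comm (b j), hab]
      exact Ideal.mul_mem_left _ _ (hr j)
    have hmem : C z ∈ Ideal.span (Set.range ((genericRow R n).mulVec (C ∘ b))) := by
      refine mem_span_of_det_mul_mem_of_quotient _ hmulVec hregular hgeneric
        (fun a' b' A' hab' ha' z' => ih hab' ha') ?_
      rw [hdet, ← map_mul, Set.range_comp, hspan]
      exact Ideal.mem_map_of_mem C hz
    simpa using Ideal.mem_map_C_iff.1 (span_genericRow_mulVec_le b hmem) 0

end GenericCombination

open MvPolynomial in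
theorem isWeaklyRegular_ofFn_X_pow {n : ℕ} {S : Type*} [CommRing S] (M : ℕ) :
    IsWeaklyRegular (MvPolynomial (Fin n) S)
      (List.ofFn fun i : Fin n => (X i ^ M : MvPolynomial (Fin n) S)) := by
  classical
  rw [isWeaklyRegular_ofFn_iff]
  intro i g hg
  have himage : (fun i : Fin n => (X i ^ M : MvPolynomial (Fin n) S)) '' Set.Iio i =
      (fun s => monomial s (1 : S)) '' ((fun j => Finsupp.single j M) '' Set.Iio i) := by
    simp only [Set.image_image, X_pow_eq_monomial]
  rw [himage, mem_ideal_span_monomial_image] at hg ⊢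
  intro α hα
  simp only [X_pow_eq_monomial] at hg
  obtain ⟨_, ⟨j, hj, rfl⟩, hle⟩ := hg (Finsupp.single i M + α) (by
    rw [mem_support_iff, coeff_monomial_mul, one_mul]
    exact mem_support_iff.1 hα)
  refine ⟨_, ⟨j, hj, rfl⟩, ?_⟩
  rw [Finsupp.single_le_iff] at hle ⊢
  simpa [Finsupp.single_apply, (ne_of_lt (Set.mem_Iio.1 hj)).symm] using hle

end WeaklyRegular

/-! ### The local ring `A₋{x}` -/

section ConvergentInverse

open Finset.HasAntidiagonal (antidiagonal mem_antidiagonal)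

variable {n : ℕ}

theorem sum_antidiagonal_pow_degree_le {q : ℝ} (hq0 : 0 ≤ q) (hq1 : q < 1) (α : Fin n →₀ ℕ) :
    ∑ p ∈ antidiagonal α, q ^ p.1.degree ≤ ((1 - q)⁻¹) ^ n := by
  classical
  calc ∑ p ∈ antidiagonal α, q ^ p.1.degree
      = ∑ f ∈ (antidiagonal α).image (fun p => (p.1 : Fin n → ℕ)), ∏ i, q ^ f i := by
        rw [Finset.sum_image]
        · refine Finset.sum_congr rfl fun p _ => ?_
          rw [Finset.prod_pow_eq_pow_sum, Finsupp.degree_eq_sum]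
        · intro p hp p' hp' h
          have hfst : p.1 = p'.1 := DFunLike.coe_injective h
          refine Prod.ext hfst (add_left_cancel (a := p.1) ?_)
          rw [mem_antidiagonal.1 hp, hfst, mem_antidiagonal.1 hp']
    _ ≤ ∑ f ∈ Fintype.piFinset fun _ : Fin n => Finset.range (α.degree + 1), ∏ i, q ^ f i := by
        refine Finset.sum_le_sum_of_subset_of_nonneg ?_ fun _ _ _ =>
          Finset.prod_nonneg fun _ _ => pow_nonneg hq0 _
        intro f hf
        obtain ⟨p, hp, rfl⟩ := Finset.mem_image.1 hf
        rw [Fintype.mem_piFinset]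
        intro i
        rw [Finset.mem_range, Nat.lt_succ_iff, ← mem_antidiagonal.1 hp, map_add]
        exact (Finsupp.le_degree i p.1).trans (Nat.le_add_right _ _)
    _ = ∏ _i : Fin n, ∑ b ∈ Finset.range (α.degree + 1), q ^ b := by rw [Finset.prod_univ_sum]
    _ ≤ ∏ _i : Fin n, (1 - q)⁻¹ := by
        refine Finset.prod_le_prod (fun _ _ => Finset.sum_nonneg fun _ _ => pow_nonneg hq0 _)
          fun _ _ => ?_
        rw [← tsum_geometric_of_lt_one hq0 hq1]
        exact (summable_geometric_of_lt_one hq0 hq1).sum_le_tsum _ fun _ _ => pow_nonneg hq0 _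
    _ = ((1 - q)⁻¹) ^ n := by simp

theorem exists_mul_inv_one_sub_pow_sub_one_le (n : ℕ) (C : ℝ) :
    ∃ q : ℝ, 0 < q ∧ q < 1 ∧ C * (((1 - q)⁻¹) ^ n - 1) ≤ 1 := by
  have hcont : ContinuousAt (fun q : ℝ => C * (((1 - q)⁻¹) ^ n - 1)) 0 := by
    have : ContinuousAt (fun q : ℝ => (1 - q)⁻¹) 0 :=
      ContinuousAt.inv₀ (by fun_prop) (by norm_num)
    fun_prop
  have hsmall : ∀ᶠ q in 𝓝[>] (0 : ℝ), C * (((1 - q)⁻¹) ^ n - 1) < 1 :=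
    (hcont.eventually_lt continuousAt_const (by simp)).filter_mono nhdsWithin_le_nhds
  have hlt : ∀ᶠ q in 𝓝[>] (0 : ℝ), q < 1 :=
    (eventually_lt_nhds one_pos).filter_mono nhdsWithin_le_nhds
  obtain ⟨q, hq, hq1, hq0⟩ := (hsmall.and (hlt.and self_mem_nhdsWithin)).exists
  exact ⟨q, hq0, hq1, hq.le⟩

theorem coeff_eq_neg_sum_of_mul_eq_one {S : Type*} [CommRing S] {u y : MvPowerSeries (Fin n) S}
    (hu : MvPowerSeries.coeff 0 u = 1) (huy : u * y = 1) {α : Fin n →₀ ℕ} (hα : α ≠ 0) :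
    MvPowerSeries.coeff α y = -∑ p ∈ (antidiagonal α).erase (0, α),
      MvPowerSeries.coeff p.1 u * MvPowerSeries.coeff p.2 y := by
  classical
  have hcoeff := congrArg (MvPowerSeries.coeff α) huy
  rw [MvPowerSeries.coeff_mul, ← Finset.add_sum_erase _ _ (a := (0, α)) (by simp), hu, one_mul,
    MvPowerSeries.coeff_one, if_neg hα] at hcoeff
  exact eq_neg_of_add_eq_zero_left hcoeff

theorem norm_sum_antidiagonal_erase_mul_le {r q C : ℝ} (hr : 0 < r) (hq : 0 < q)
    {u y : MvPowerSeries (Fin n) ℂ} (hu : CoeffBound r C u) {α : Fin n →₀ ℕ}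
    (hy : ∀ β : Fin n →₀ ℕ, β.degree < α.degree →
      ‖MvPowerSeries.coeff β y‖ * (r * q) ^ β.degree ≤ 1) :
    ‖∑ p ∈ (antidiagonal α).erase (0, α),
        MvPowerSeries.coeff p.1 u * MvPowerSeries.coeff p.2 y‖ * (r * q) ^ α.degree ≤
      C * ((∑ p ∈ antidiagonal α, q ^ p.1.degree) - 1) := by
  classical
  have hterm : ∀ p ∈ (antidiagonal α).erase (0, α),
      ‖MvPowerSeries.coeff p.1 u * MvPowerSeries.coeff p.2 y‖ * (r * q) ^ α.degree ≤
        C * q ^ p.1.degree := by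
    intro p hp
    rw [Finset.mem_erase, mem_antidiagonal] at hp
    have hdeg : α.degree = p.1.degree + p.2.degree := by rw [← hp.2, map_add]
    have hfst : p.1.degree ≠ 0 := fun h => by
      have h0 : p.1 = 0 := (Finsupp.degree_eq_zero_iff _).1 h
      exact hp.1 (Prod.ext h0 (by rw [← hp.2, h0, zero_add]))
    rw [hdeg, pow_add, norm_mul, mul_mul_mul_comm]
    calc ‖MvPowerSeries.coeff p.1 u‖ * (r * q) ^ p.1.degree *
            (‖MvPowerSeries.coeff p.2 y‖ * (r * q) ^ p.2.degree)
        ≤ ‖MvPowerSeries.coeff p.1 u‖ * (r * q) ^ p.1.degree * 1 :=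
          mul_le_mul_of_nonneg_left (hy _ (by omega)) (by positivity)
      _ = (‖MvPowerSeries.coeff p.1 u‖ * r ^ p.1.degree) * q ^ p.1.degree := by
          rw [mul_pow]; ring
      _ ≤ C * q ^ p.1.degree := mul_le_mul_of_nonneg_right (hu _) (by positivity)
  calc _ ≤ (∑ p ∈ (antidiagonal α).erase (0, α),
          ‖MvPowerSeries.coeff p.1 u * MvPowerSeries.coeff p.2 y‖) * (r * q) ^ α.degree :=
        mul_le_mul_of_nonneg_right (norm_sum_le _ _) (by positivity)
    _ ≤ ∑ p ∈ (antidiagonal α).erase (0, α), C * q ^ p.1.degree := by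
        rw [Finset.sum_mul]
        exact Finset.sum_le_sum hterm
    _ = C * ((∑ p ∈ antidiagonal α, q ^ p.1.degree) - 1) := by
        rw [← Finset.add_sum_erase (antidiagonal α) (fun p => q ^ p.1.degree) (a := (0, α))
          (by simp), ← Finset.mul_sum, map_zero, pow_zero, add_sub_cancel_left]

theorem exists_coeffBound_of_mul_eq_one (n : ℕ) {r : ℝ} (hr : 0 < r) (C : ℝ) :
    ∃ ρ > 0, ∀ u y : MvPowerSeries (Fin n) ℂ, CoeffBound r C u →
      MvPowerSeries.coeff 0 u = 1 → u * y = 1 → CoeffBound ρ 1 y := by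
  obtain ⟨q, hq0, hq1, hq⟩ := exists_mul_inv_one_sub_pow_sub_one_le n C
  refine ⟨r * q, by positivity, fun u y hu hu0 huy α => ?_⟩
  induction hN : α.degree using Nat.strong_induction_on generalizing α with
  | _ N ih =>
  subst hN
  rcases eq_or_ne α 0 with rfl | hα
  · have hy0 := congrArg (MvPowerSeries.coeff 0) huy
    simp only [MvPowerSeries.coeff_zero_eq_constantCoeff, map_mul, map_one] at hy0 hu0
    rw [hu0, one_mul] at hy0
    simp [hy0]
  · rw [coeff_eq_neg_sum_of_mul_eq_one hu0 huy hα, norm_neg]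
    calc _ ≤ C * ((∑ p ∈ antidiagonal α, q ^ p.1.degree) - 1) :=
          norm_sum_antidiagonal_erase_mul_le hr hq0 hu fun β hβ => ih _ hβ β rfl
      _ ≤ C * (((1 - q)⁻¹) ^ n - 1) :=
          mul_le_mul_of_nonneg_left
            (sub_le_sub_right (sum_antidiagonal_pow_degree_le hq0.le hq1 α) 1) hu.nonneg
      _ ≤ 1 := hq

end ConvergentInverse

section RelSeries

variable {n k : ℕ}

theorem toSeries_injective : Function.Injective (toSeries n k) := Subtype.val_injective

theorem exists_toSeries_eq {g : MvPowerSeries (Fin n) (Base k)} (hg : g ∈ relSubalgebra n k) :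
    ∃ h : RelSeries n k, toSeries n k h = g :=
  ⟨(⟨g, hg⟩ : relSubalgebra n k), rfl⟩

theorem isUnit_of_coeff_zero_eq_one {g : RelSeries n k}
    (hg : MvPowerSeries.coeff 0 (toSeries n k g) = 1) : IsUnit g := by
  set y := MvPowerSeries.invOfUnit (toSeries n k g) 1
  have hy : toSeries n k g * y = 1 := MvPowerSeries.mul_invOfUnit _ _ (by simpa using hg)
  have hmem : y ∈ relSubalgebra n k := by
    intro R
    obtain ⟨r, hr, C, hC⟩ := g.2 R
    obtain ⟨ρ, hρ, h⟩ := exists_coeffBound_of_mul_eq_one n hr C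
    refine ⟨ρ, hρ, 1, fun t ht => h _ _ (hC t ht) ?_ ?_⟩
    · rw [MvPowerSeries.coeff_map]
      exact (congrArg _ hg).trans (map_one _)
    · rw [← map_mul]
      exact (congrArg _ hy).trans (map_one _)
  obtain ⟨y', hy'⟩ := exists_toSeries_eq hmem
  exact IsUnit.of_mul_eq_one y' (toSeries_injective (by rw [map_mul, hy', hy, map_one]))

/-- The `i`-th part of a series in the decomposition `g = g(0) + ∑ xᵢ gᵢ`, where `xᵢ gᵢ` collects
the monomials of `g` whose first variable is `xᵢ`. -/
def divVar {S : Type*} [CommRing S] (i : Fin n) (g : MvPowerSeries (Fin n) S) :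
    MvPowerSeries (Fin n) S :=
  fun α => if ∀ j < i, α j = 0 then MvPowerSeries.coeff (α + Finsupp.single i 1) g else 0

theorem coeff_divVar {S : Type*} [CommRing S] (i : Fin n) (g : MvPowerSeries (Fin n) S)
    (α : Fin n →₀ ℕ) : MvPowerSeries.coeff α (divVar i g) =
      if ∀ j < i, α j = 0 then MvPowerSeries.coeff (α + Finsupp.single i 1) g else 0 := rfl

theorem coeff_X_mul_divVar {S : Type*} [CommRing S] (i : Fin n) (g : MvPowerSeries (Fin n) S)
    (α : Fin n →₀ ℕ) : MvPowerSeries.coeff α (MvPowerSeries.X i * divVar i g) =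
      if α i ≠ 0 ∧ ∀ j < i, α j = 0 then MvPowerSeries.coeff α g else 0 := by
  classical
  rw [MvPowerSeries.X_def, MvPowerSeries.coeff_monomial_mul, one_mul, coeff_divVar]
  simp only [Finsupp.single_le_iff, Nat.one_le_iff_ne_zero]
  by_cases hi : α i ≠ 0
  · have hfirst : (∀ j < i, (α - Finsupp.single i 1 : Fin n →₀ ℕ) j = 0) ↔ ∀ j < i, α j = 0 :=
      forall₂_congr fun j hj => by
        rw [Finsupp.tsub_apply, Finsupp.single_eq_of_ne hj.ne, tsub_zero]
    rw [if_pos hi, tsub_add_cancel_of_le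
      (Finsupp.single_le_iff.2 (Nat.one_le_iff_ne_zero.2 hi))]
    simp only [hfirst, hi, ne_eq, not_false_eq_true, true_and]
  · rw [if_neg hi, if_neg fun h => hi h.1]

theorem C_add_sum_X_mul_divVar {S : Type*} [CommRing S] (g : MvPowerSeries (Fin n) S) :
    MvPowerSeries.C (MvPowerSeries.coeff 0 g) + ∑ i, MvPowerSeries.X i * divVar i g = g := by
  classical
  ext α
  simp only [map_add, map_sum, coeff_X_mul_divVar, MvPowerSeries.coeff_C]
  rcases eq_or_ne α 0 with rfl | hα
  · simp
  obtain ⟨i, hi, hmin⟩ : ∃ i, α i ≠ 0 ∧ ∀ j < i, α j = 0 := by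
    obtain ⟨i, hi, hmin⟩ := Set.exists_min_image {i | α i ≠ 0} id (Set.toFinite _)
      (Finsupp.ne_iff.1 hα)
    exact ⟨i, hi, fun j hj => not_not.1 fun h => (hmin j h).not_gt hj⟩
  rw [if_neg hα, zero_add, Finset.sum_eq_single i, if_pos ⟨hi, hmin⟩]
  · exact fun j _ hj => if_neg fun h =>
      hj.lt_or_gt.elim (fun hlt => h.1 (hmin j hlt)) fun hlt => hi (h.2 i hlt)
  · exact fun h => absurd (Finset.mem_univ i) h

theorem divVar_mem_relSubalgebra (i : Fin n) {g : MvPowerSeries (Fin n) (Base k)}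
    (hg : g ∈ relSubalgebra n k) : divVar i g ∈ relSubalgebra n k := by
  intro R
  obtain ⟨r, hr, C, hC⟩ := hg R
  refine ⟨r, hr, C / r, fun t ht α => ?_⟩
  have hC0 := (hC t ht).nonneg
  rw [MvPowerSeries.coeff_map, coeff_divVar]
  split_ifs
  · have h := hC t ht (α + Finsupp.single i 1)
    rw [MvPowerSeries.coeff_map, map_add, Finsupp.degree_single, pow_succ, ← mul_assoc] at h
    rwa [le_div_iff₀ hr]
  · rw [map_zero, norm_zero, zero_mul]
    positivity

theorem exists_eq_polyToRel_C_add_sum (g : RelSeries n k) :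
    ∃ h : Fin n → RelSeries n k,
      g = polyToRel n k (MvPolynomial.C (MvPowerSeries.coeff 0 (toSeries n k g))) +
        ∑ i, polyToRel n k (MvPolynomial.X i) * h i := by
  choose h hh using fun i => exists_toSeries_eq (divVar_mem_relSubalgebra i g.2)
  refine ⟨h, toSeries_injective ?_⟩
  simp only [map_add, map_sum, map_mul, coe_polyToRel, MvPolynomial.coe_C, MvPolynomial.coe_X, hh]
  exact (C_add_sum_X_mul_divVar _).symm

theorem mem_xIdeal_iff_coeff_zero {g : RelSeries n k} :
    g ∈ xIdeal n k ↔ MvPowerSeries.coeff 0 (toSeries n k g) = 0 := by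
  constructor
  · have hle : xIdeal n k ≤
        RingHom.ker (MvPowerSeries.constantCoeff.comp (toSeries n k).toRingHom) := by
      rw [xIdeal, Ideal.span_le]
      rintro _ ⟨i, rfl⟩
      simp [RingHom.mem_ker, coe_polyToRel]
    exact fun hg => by simpa using hle hg
  · intro hg
    obtain ⟨h, hgh⟩ := exists_eq_polyToRel_C_add_sum g
    rw [hgh, hg, map_zero, map_zero, zero_add]
    exact Ideal.sum_mem _ fun i _ => Ideal.mul_mem_right _ _ (Ideal.subset_span ⟨i, rfl⟩)

theorem xIdeal_le_jacobson : xIdeal n k ≤ Ideal.jacobson ⊥ := by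
  intro g hg
  rw [Ideal.mem_jacobson_bot]
  intro y
  refine isUnit_of_coeff_zero_eq_one ?_
  rw [map_add, map_add, mem_xIdeal_iff_coeff_zero.1 (Ideal.mul_mem_right _ _ hg)]
  simp

theorem exists_sub_polyToRel_mem_xIdeal_pow (N : ℕ) (g : RelSeries n k) :
    ∃ p : MvPolynomial (Fin n) (Base k), g - polyToRel n k p ∈ xIdeal n k ^ N := by
  induction N generalizing g with
  | zero => exact ⟨0, by simp⟩
  | succ N ih =>
    obtain ⟨h, hgh⟩ := exists_eq_polyToRel_C_add_sum g
    choose p hp using fun i => ih (h i)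
    refine ⟨MvPolynomial.C (MvPowerSeries.coeff 0 (toSeries n k g)) +
      ∑ i, MvPolynomial.X i * p i, ?_⟩
    nth_rewrite 1 [hgh]
    simp only [map_add, map_sum, map_mul, add_sub_add_left_eq_sub, ← Finset.sum_sub_distrib,
      ← mul_sub]
    rw [pow_succ']
    exact Ideal.sum_mem _ fun i _ => Ideal.mul_mem_mul (Ideal.subset_span ⟨i, rfl⟩) (hp i)

end RelSeries

/-! ### Quasihomogeneous isolated singularities -/

section Quasihomogeneous

open MvPolynomial

/-- Natural weights regarded as integers, so that degrees may become negative. -/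
def intWeight {σ : Type*} (w : σ → ℕ) (i : σ) : ℤ := w i

theorem weight_intWeight {σ : Type*} (w : σ → ℕ) (α : σ →₀ ℕ) :
    Finsupp.weight (intWeight w) α = (Finsupp.weight w α : ℤ) := by
  simp [Finsupp.weight_apply, Finsupp.sum, intWeight]

theorem isWeightedHomogeneous_intWeight {σ S : Type*} [CommSemiring S] {w : σ → ℕ}
    {p : MvPolynomial σ S} {e : ℕ} (hp : IsWeightedHomogeneous w p e) :
    IsWeightedHomogeneous (intWeight w) p (e : ℤ) := fun α hα => by
  rw [weight_intWeight, hp hα]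

theorem isWeightedHomogeneous_pderiv {σ S : Type*} [CommSemiring S] {w : σ → ℕ}
    {p : MvPolynomial σ S} {e : ℕ} (hp : IsWeightedHomogeneous w p e) (i : σ) :
    IsWeightedHomogeneous (intWeight w) (pderiv i p) ((e : ℤ) - w i) :=
  (isWeightedHomogeneous_intWeight hp).pderiv (by simp [intWeight])

theorem eval_pow_mul {K : Type*} [Field K] {n : ℕ} {w : Fin n → ℕ}
    {p : MvPolynomial (Fin n) K} {e : ℤ} (hp : IsWeightedHomogeneous (intWeight w) p e)
    (c : K) (x : Fin n → K) : eval (fun i => c ^ w i * x i) p = c ^ e * eval x p := by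
  rw [eval_eq', eval_eq', Finset.mul_sum]
  refine Finset.sum_congr rfl fun α hα => ?_
  rw [← hp (mem_support_iff.1 hα), weight_intWeight, zpow_natCast, Finsupp.weight_eq_sum]
  simp only [mul_pow, Finset.prod_mul_distrib, ← pow_mul, Finset.prod_pow_eq_pow_sum, smul_eq_mul,
    mul_comm (w _)]
  ring

variable {n : ℕ}

/-- The Jacobian ideal of `f` in the polynomial ring. -/
def polyJacobian (f : MvPolynomial (Fin n) ℂ) : Ideal (MvPolynomial (Fin n) ℂ) :=
  Ideal.span (Set.range fun i => pderiv i f)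

variable {w : Fin n → ℕ} {d : ℕ} {f : MvPolynomial (Fin n) ℂ}

theorem HasIsolatedSingularity.degree_ne_zero [Nonempty (Fin n)] (hsing : HasIsolatedSingularity f)
    (hw : ∀ i, 0 < w i) (hf : IsWeightedHomogeneous w f d) : d ≠ 0 := by
  rintro rfl
  have hconst : f = C (coeff 0 f) :=
    hf.weightedHomogeneousComponent_same.symm.trans
      (weightedHomogeneousComponent_zero f fun i => (hw i).ne')
  have hcoeff : coeff 0 f = 0 := by
    have heval := hsing.1.1
    rwa [hconst, eval_C] at heval
  rw [hcoeff, C_0] at hconst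
  have : (𝓝[≠] (0 : Fin n → ℂ)).NeBot := Module.punctured_nhds_neBot ℂ (Fin n → ℂ) 0
  obtain ⟨x, hx⟩ := hsing.2.exists
  exact hx (by simp [hconst])

theorem tendsto_pow_mul_punctured_nhds_zero (hw : ∀ i, 0 < w i) {x : Fin n → ℂ} (hx : x ≠ 0) :
    Filter.Tendsto (fun c : ℂ => fun i => c ^ w i * x i) (𝓝[≠] 0) (𝓝[≠] (0 : Fin n → ℂ)) := by
  obtain ⟨i, hi⟩ := Function.ne_iff.1 hx
  refine tendsto_nhdsWithin_iff.2 ⟨?_, ?_⟩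
  · have hcont : Continuous fun c : ℂ => fun i => c ^ w i * x i := by fun_prop
    have hzero : (fun i => (0 : ℂ) ^ w i * x i) = 0 := by
      ext i
      simp [(hw i).ne']
    exact (hcont.tendsto' 0 0 hzero).mono_left nhdsWithin_le_nhds
  · filter_upwards [self_mem_nhdsWithin] with c hc h
    exact mul_ne_zero (pow_ne_zero _ hc) hi (congrFun h i)

/-- The `ℂ*`-action given by the weights moves a common zero of the partial derivatives into any
neighbourhood of the origin. -/
theorem HasIsolatedSingularity.eq_zero_of_eval_pderiv (hsing : HasIsolatedSingularity f)
    (hw : ∀ i, 0 < w i) (hf : IsWeightedHomogeneous w f d) {x : Fin n → ℂ}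
    (hx : ∀ i, eval x (pderiv i f) = 0) : x = 0 := by
  by_contra hne
  have : Nonempty (Fin n) := ⟨(Function.ne_iff.1 hne).choose⟩
  obtain ⟨c, hc⟩ :=
    ((tendsto_pow_mul_punctured_nhds_zero hw hne).eventually hsing.2).exists
  have hpderiv : ∀ i, eval (fun i => c ^ w i * x i) (pderiv i f) = 0 := fun i => by
    rw [eval_pow_mul (isWeightedHomogeneous_pderiv hf i), hx, mul_zero]
  have heuler := congrArg (eval fun i => c ^ w i * x i) hf.sum_weight_X_mul_pderiv
  simp only [map_sum, nsmul_eq_mul, map_mul, hpderiv, mul_zero, Finset.sum_const_zero,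
    map_natCast] at heuler
  exact hc ⟨(mul_eq_zero.1 heuler.symm).resolve_left
    (Nat.cast_ne_zero.2 (hsing.degree_ne_zero hw hf)), hpderiv⟩

theorem HasIsolatedSingularity.exists_X_pow_mem_polyJacobian (hsing : HasIsolatedSingularity f)
    (hw : ∀ i, 0 < w i) (hf : IsWeightedHomogeneous w f d) :
    ∃ M : ℕ, ∀ i, (X i ^ M : MvPolynomial (Fin n) ℂ) ∈ polyJacobian f := by
  have hradical : ∀ i, (X i : MvPolynomial (Fin n) ℂ) ∈ (polyJacobian f).radical := by
    intro i
    rw [← vanishingIdeal_zeroLocus_eq_radical (K := ℂ)]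
    intro x hx
    have hx0 : x = 0 := hsing.eq_zero_of_eval_pderiv hw hf fun j => by
      simpa [aeval_eq_eval] using hx (pderiv j f) (Ideal.subset_span ⟨j, rfl⟩)
    simp [hx0]
  choose M hM using hradical
  exact ⟨∑ i, M i, fun i => Ideal.pow_mem_of_pow_mem _ (hM i)
    (Finset.single_le_sum (f := M) (fun _ _ => Nat.zero_le _) (Finset.mem_univ i))⟩

theorem exists_coeff_eq_ite_weight {S : Type*} [CommSemiring S] (hw : ∀ i, 0 < w i) (e : ℤ)
    (s : MvPowerSeries (Fin n) S) :
    ∃ p : MvPolynomial (Fin n) S, ∀ α, coeff α p =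
      if Finsupp.weight (intWeight w) α = e then MvPowerSeries.coeff α s else 0 := by
  classical
  have hfin : {α : Fin n →₀ ℕ | Finsupp.weight (intWeight w) α = e}.Finite := by
    refine (Finsupp.finite_of_nat_weight_le w (fun i => (hw i).ne') e.toNat).subset fun α hα => ?_
    have : (Finsupp.weight w α : ℤ) = e := by rw [← weight_intWeight]; exact hα
    change Finsupp.weight w α ≤ e.toNat
    omega
  refine ⟨∑ β ∈ hfin.toFinset, monomial β (MvPowerSeries.coeff β s), fun α => ?_⟩
  simp only [coeff_sum, coeff_monomial, Finset.sum_ite_eq', Set.Finite.mem_toFinset,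
    Set.mem_ofPred_eq]

theorem exists_weightedHomogeneousComponent_eq_sum (hw : ∀ i, 0 < w i)
    (hf : IsWeightedHomogeneous w f d) (e : ℤ) {p : MvPolynomial (Fin n) ℂ}
    {S : Fin n → MvPowerSeries (Fin n) ℂ}
    (hp : (p : MvPowerSeries (Fin n) ℂ) = ∑ i, S i * (pderiv i f : MvPolynomial (Fin n) ℂ)) :
    ∃ s : Fin n → MvPolynomial (Fin n) ℂ,
      (∀ i, IsWeightedHomogeneous (intWeight w) (s i) (e - (d - w i))) ∧
      weightedHomogeneousComponent (intWeight w) e p = ∑ i, s i * pderiv i f := by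
  classical
  choose s hs using fun i => exists_coeff_eq_ite_weight hw (e - (d - w i)) (S i)
  have hhom : ∀ i, IsWeightedHomogeneous (intWeight w) (s i) (e - (d - w i)) := by
    intro i α hα
    by_contra h
    exact hα ((hs i α).trans (if_neg h))
  refine ⟨s, hhom, ?_⟩
  ext α
  rw [coeff_weightedHomogeneousComponent, coeff_sum]
  split_ifs with h
  · rw [← coeff_coe, hp, map_sum]
    refine Finset.sum_congr rfl fun i _ => ?_
    rw [MvPowerSeries.coeff_mul, coeff_mul]
    refine Finset.sum_congr rfl fun q hq => ?_
    rw [coeff_coe]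
    by_cases hq0 : coeff q.2 (pderiv i f) = 0
    · rw [hq0, mul_zero, mul_zero]
    · have hweight := isWeightedHomogeneous_pderiv hf i hq0
      rw [← Finset.HasAntidiagonal.mem_antidiagonal.1 hq, map_add] at h
      rw [hs, if_pos (by omega)]
  · refine (Finset.sum_eq_zero fun i _ => ?_).symm
    refine ((hhom i).mul (isWeightedHomogeneous_pderiv hf i)).coeff_eq_zero α ?_
    rwa [sub_add_cancel]

theorem exists_homogeneous_eq_sum_of_mem_polyJacobian (hw : ∀ i, 0 < w i)
    (hf : IsWeightedHomogeneous w f d) {e : ℤ} {p : MvPolynomial (Fin n) ℂ}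
    (hp : p ∈ polyJacobian f) (he : IsWeightedHomogeneous (intWeight w) p e) :
    ∃ s : Fin n → MvPolynomial (Fin n) ℂ,
      (∀ i, IsWeightedHomogeneous (intWeight w) (s i) (e - (d - w i))) ∧
      p = ∑ i, s i * pderiv i f := by
  obtain ⟨c, rfl⟩ := (Submodule.mem_span_range_iff_exists_fun _).1 hp
  have hcoe : ((∑ i, c i • pderiv i f : MvPolynomial (Fin n) ℂ) : MvPowerSeries (Fin n) ℂ) =
      ∑ i, (c i : MvPowerSeries (Fin n) ℂ) * (pderiv i f : MvPolynomial (Fin n) ℂ) := by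
    simp only [← coeToMvPowerSeries.ringHom_apply, map_sum, smul_eq_mul, map_mul]
  obtain ⟨s, hs, h⟩ := exists_weightedHomogeneousComponent_eq_sum hw hf e hcoe
  exact ⟨s, hs, by rw [← h, he.weightedHomogeneousComponent_same]⟩

end Quasihomogeneous

section MonomialBasis

open MvPolynomial

variable {n : ℕ} {f : MvPolynomial (Fin n) ℂ} {B : Set (Fin n →₀ ℕ)}

theorem mk_polyToConv_eq_zero {p : MvPolynomial (Fin n) ℂ} (hp : p ∈ polyJacobian f) :
    (Ideal.Quotient.mk (Ideal.span (Set.range fun i => polyToConv n (pderiv i f)))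
      (polyToConv n p) : MilnorAlgebra f) = 0 := by
  rw [Ideal.Quotient.eq_zero_iff_mem]
  have h := Ideal.mem_map_of_mem (polyToConv n) hp
  rw [polyJacobian, Ideal.map_span, ← Set.range_comp] at h
  exact h

theorem mk_polyToConv_sum_smul_monomial [Fintype B] (c : B → ℂ) :
    (Ideal.Quotient.mk (Ideal.span (Set.range fun i => polyToConv n (pderiv i f)))
      (polyToConv n (∑ α : B, c α • monomial (α : Fin n →₀ ℕ) (1 : ℂ))) : MilnorAlgebra f) =
      ∑ α : B, c α • milnorMonomial f α := by
  rw [map_sum, map_sum]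
  refine Finset.sum_congr rfl fun α _ => ?_
  rw [map_smul]
  rfl

theorem exists_coe_eq_sum_mul_pderiv {p : MvPolynomial (Fin n) ℂ}
    (hp : polyToConv n p ∈ Ideal.span (Set.range fun i => polyToConv n (pderiv i f))) :
    ∃ S : Fin n → MvPowerSeries (Fin n) ℂ, (p : MvPowerSeries (Fin n) ℂ) =
      ∑ i, S i * (pderiv i f : MvPolynomial (Fin n) ℂ) := by
  obtain ⟨S, hS⟩ := (Submodule.mem_span_range_iff_exists_fun _).1 hp
  refine ⟨fun i => S i, ?_⟩
  rw [← coe_polyToConv, ← hS, AddSubmonoidClass.coe_finsetSum]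
  refine Finset.sum_congr rfl fun i _ => ?_
  rw [smul_eq_mul, MulMemClass.coe_mul, coe_polyToConv]

namespace IsMonomialBasis

theorem eq_zero_of_sum_mem [Fintype B] (hB : IsMonomialBasis f B) {c : B → ℂ}
    (hc : ∑ α : B, c α • monomial (α : Fin n →₀ ℕ) (1 : ℂ) ∈ polyJacobian f) : c = 0 :=
  funext (Fintype.linearIndependent_iff.1 hB.1 c
    ((mk_polyToConv_sum_smul_monomial c).symm.trans (mk_polyToConv_eq_zero hc)))

theorem monomial_notMem (hB : IsMonomialBasis f B) {α : Fin n →₀ ℕ} (hα : α ∈ B) :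
    monomial α (1 : ℂ) ∉ polyJacobian f := fun h =>
  hB.1.ne_zero (⟨α, hα⟩ : B) (mk_polyToConv_eq_zero h)

theorem exists_polyToConv_sub_sum_mem [Fintype B] (hB : IsMonomialBasis f B) (γ : Fin n →₀ ℕ) :
    ∃ c : B → ℂ,
      polyToConv n (monomial γ 1 - ∑ α : B, c α • monomial (α : Fin n →₀ ℕ) (1 : ℂ)) ∈
        Ideal.span (Set.range fun i => polyToConv n (pderiv i f)) := by
  have hspan : milnorMonomial f γ ∈
      Submodule.span ℂ (Set.range fun α : B => milnorMonomial f α) := by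
    rw [← Set.image_eq_range (milnorMonomial f) B, hB.2]
    exact Submodule.mem_top
  obtain ⟨c, hc⟩ := (Submodule.mem_span_range_iff_exists_fun _).1 hspan
  refine ⟨c, Ideal.Quotient.eq_zero_iff_mem.1 ?_⟩
  rw [map_sub, map_sub, mk_polyToConv_sum_smul_monomial, hc]
  exact sub_self _

theorem exists_division [Fintype B] (hB : IsMonomialBasis f B) {w : Fin n → ℕ}
    (hw : ∀ i, 0 < w i) {d : ℕ} (hf : IsWeightedHomogeneous w f d) (γ : Fin n →₀ ℕ) :
    ∃ (c : B → ℂ) (s : Fin n → MvPolynomial (Fin n) ℂ),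
      (∀ α : B, c α ≠ 0 → Finsupp.weight w (α : Fin n →₀ ℕ) = Finsupp.weight w γ) ∧
      (∀ i, IsWeightedHomogeneous (intWeight w) (s i) (Finsupp.weight w γ - (d - w i))) ∧
      monomial γ 1 = ∑ α : B, c α • monomial (α : Fin n →₀ ℕ) (1 : ℂ) + ∑ i, s i * pderiv i f := by
  classical
  obtain ⟨c, hc⟩ := hB.exists_polyToConv_sub_sum_mem γ
  obtain ⟨S, hS⟩ := exists_coe_eq_sum_mul_pderiv hc
  obtain ⟨s, hs, hcomp⟩ :=
    exists_weightedHomogeneousComponent_eq_sum hw hf (Finsupp.weight w γ) hS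
  refine ⟨fun α => if Finsupp.weight w (α : Fin n →₀ ℕ) = Finsupp.weight w γ then c α else 0, s,
    fun α hα => (ite_ne_right_iff.1 hα).1, hs, ?_⟩
  have hmonomial (α : Fin n →₀ ℕ) :=
    isWeightedHomogeneous_monomial (intWeight w) α (1 : ℂ) (weight_intWeight w α)
  rw [← hcomp, map_sub, map_sum, (hmonomial γ).weightedHomogeneousComponent_same,
    add_sub_left_comm, left_eq_add, ← Finset.sum_sub_distrib]
  refine Finset.sum_eq_zero fun α _ => ?_
  rw [map_smul, weightedHomogeneousComponent_of_mem (hmonomial α)]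
  by_cases hαγ : Finsupp.weight w (α : Fin n →₀ ℕ) = Finsupp.weight w γ
  · simp [hαγ]
  · simp [hαγ, Ne.symm hαγ]

theorem lt_of_mem (hB : IsMonomialBasis f B) {M : ℕ}
    (hM : ∀ i, (X i ^ M : MvPolynomial (Fin n) ℂ) ∈ polyJacobian f) {α : Fin n →₀ ℕ} (hα : α ∈ B)
    (i : Fin n) : α i < M := by
  by_contra h
  refine hB.monomial_notMem hα (Ideal.mem_of_dvd _ ?_ (hM i))
  rw [X_pow_eq_monomial, monomial_dvd_monomial]
  exact ⟨Or.inr (Finsupp.single_le_iff.2 (not_lt.1 h)), dvd_rfl⟩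

theorem finite (hB : IsMonomialBasis f B) {M : ℕ}
    (hM : ∀ i, (X i ^ M : MvPolynomial (Fin n) ℂ) ∈ polyJacobian f) : B.Finite :=
  (Set.finite_Iic (Finsupp.equivFunOnFinite.symm fun _ : Fin n => M)).subset fun _ hα i =>
    (hB.lt_of_mem hM hα i).le

end IsMonomialBasis

end MonomialBasis

/-! ### Division by the partial derivatives of `F` -/

section JointlyHomogeneous

open MvPolynomial

variable {n k : ℕ} {w : Fin n → ℕ} {v : Fin k → ℤ} {p q : MvPolynomial (Fin n) (Base k)} {e e' : ℤ}

/-- `p ∈ A₋[x]` is homogeneous of degree `e` in `x` and `t` together, the polynomial counterpart of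
`IsHomogeneousSeries`. -/
def IsJointlyHomogeneous (w : Fin n → ℕ) (v : Fin k → ℤ) (p : MvPolynomial (Fin n) (Base k))
    (e : ℤ) : Prop :=
  ∀ α, IsWeightedHomogeneous v (coeff α p) (e - Finsupp.weight w α)

theorem IsJointlyHomogeneous.isHomogeneousSeries (hp : IsJointlyHomogeneous w v p e) :
    IsHomogeneousSeries w v (polyToRel n k p) e := fun α => by
  rw [coe_polyToRel, coeff_coe]
  exact hp α

theorem IsJointlyHomogeneous.add (hp : IsJointlyHomogeneous w v p e)
    (hq : IsJointlyHomogeneous w v q e) : IsJointlyHomogeneous w v (p + q) e := fun α => by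
  rw [coeff_add]
  exact (hp α).add (hq α)

theorem IsJointlyHomogeneous.neg (hp : IsJointlyHomogeneous w v p e) :
    IsJointlyHomogeneous w v (-p) e := fun α => by
  rw [coeff_neg]
  exact (hp α).neg

theorem IsJointlyHomogeneous.sum {ι : Type*} {s : Finset ι} {p : ι → MvPolynomial (Fin n) (Base k)}
    (hp : ∀ i ∈ s, IsJointlyHomogeneous w v (p i) e) :
    IsJointlyHomogeneous w v (∑ i ∈ s, p i) e := fun α => by
  rw [coeff_sum]
  exact IsWeightedHomogeneous.sum _ _ _ fun i hi => hp i hi α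

theorem IsJointlyHomogeneous.mul (hp : IsJointlyHomogeneous w v p e)
    (hq : IsJointlyHomogeneous w v q e') : IsJointlyHomogeneous w v (p * q) (e + e') := fun α => by
  classical
  rw [coeff_mul]
  refine IsWeightedHomogeneous.sum _ _ _ fun x hx => ?_
  convert (hp x.1).mul (hq x.2) using 1
  rw [← Finset.HasAntidiagonal.mem_antidiagonal.1 hx, map_add]
  push_cast
  ring

theorem isJointlyHomogeneous_monomial {a : Base k} (ha : IsWeightedHomogeneous v a e)
    (α : Fin n →₀ ℕ) :
    IsJointlyHomogeneous w v (monomial α a) (e + Finsupp.weight w α) := fun β => by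
  classical
  rw [coeff_monomial]
  split_ifs with h
  · rwa [← h, add_sub_cancel_right]
  · exact isWeightedHomogeneous_zero _ _ _

theorem IsJointlyHomogeneous.pderiv (hp : IsJointlyHomogeneous w v p e) (i : Fin n) :
    IsJointlyHomogeneous w v (pderiv i p) (e - w i) := fun α => by
  have hscalar : IsWeightedHomogeneous v ((α i : Base k) + 1) 0 := by
    simpa only [map_add, map_natCast, map_one] using isWeightedHomogeneous_C v ((α i : ℂ) + 1)
  rw [coeff_pderiv]
  convert (hp (α + Finsupp.single i 1)).mul hscalar using 1
  rw [map_add, Finsupp.weight_single, one_smul]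
  push_cast
  ring

theorem isJointlyHomogeneous_map_C {p : MvPolynomial (Fin n) ℂ}
    (hp : IsWeightedHomogeneous (intWeight w) p e) :
    IsJointlyHomogeneous w v (map C p : MvPolynomial (Fin n) (Base k)) e := fun α => by
  rw [coeff_map]
  by_cases h : coeff α p = 0
  · rw [h, C_0]
    exact isWeightedHomogeneous_zero _ _ _
  · rw [← hp h, weight_intWeight, sub_self]
    exact isWeightedHomogeneous_C _ _

end JointlyHomogeneous

section Division

open MvPolynomial

variable {n k : ℕ}

/-- The situation of the theorem, without the analytic form of the isolated singularity: a
quasihomogeneous polynomial `f₀` of positive degree, a monomial basis `B` of its Milnor algebra, an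
enumeration `m` of the upper monomials, and an exponent `M` such that all `xᵢ ^ M` lie in the
Jacobian ideal of `f₀`. -/
structure IsUpperUnfolding (w : Fin n → ℕ) (d : ℕ) (f₀ : MvPolynomial (Fin n) ℂ)
    (B : Set (Fin n →₀ ℕ)) (m : Fin k → (Fin n →₀ ℕ)) (M : ℕ) : Prop where
  weight_pos : ∀ i, 0 < w i
  degree_ne_zero : d ≠ 0
  homogeneous : IsWeightedHomogeneous w f₀ d
  basis : IsMonomialBasis f₀ B
  upper : EnumeratesUpper w d B m
  pow_mem : ∀ i, (X i ^ M : MvPolynomial (Fin n) ℂ) ∈ polyJacobian f₀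

variable {w : Fin n → ℕ} {d : ℕ} {f₀ : MvPolynomial (Fin n) ℂ} {B : Set (Fin n →₀ ℕ)}
  {m : Fin k → (Fin n →₀ ℕ)} {M : ℕ}

namespace IsUpperUnfolding

theorem mem_and_lt_weight (D : IsUpperUnfolding w d f₀ B m M) (j : Fin k) :
    m j ∈ B ∧ d < Finsupp.weight w (m j) := by
  have hj : m j ∈ {α | α ∈ B ∧ d < Finsupp.weight w α} := D.upper.range_eq ▸ Set.mem_range_self j
  exact hj

theorem finite (D : IsUpperUnfolding w d f₀ B m M) : B.Finite :=
  D.basis.finite D.pow_mem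

end IsUpperUnfolding

/-- The deformation term `F - f₀ = ∑ t_j m_j`. -/
def deformation (m : Fin k → (Fin n →₀ ℕ)) : MvPolynomial (Fin n) (Base k) :=
  ∑ j, monomial (m j) (X j : Base k)

theorem unfoldingPoly_eq (f₀ : MvPolynomial (Fin n) ℂ) (m : Fin k → (Fin n →₀ ℕ)) :
    unfoldingPoly f₀ m = map C f₀ + deformation m := rfl

theorem isJointlyHomogeneous_deformation (w : Fin n → ℕ) (d : ℕ) (m : Fin k → (Fin n →₀ ℕ)) :
    IsJointlyHomogeneous w (tWeight w d m) (deformation m) d :=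
  IsJointlyHomogeneous.sum fun j _ => by
    convert isJointlyHomogeneous_monomial (isWeightedHomogeneous_X ℂ (tWeight w d m) j) (m j)
      using 1
    exact (sub_add_cancel _ _).symm

theorem isJointlyHomogeneous_unfoldingPoly (hf : IsWeightedHomogeneous w f₀ d)
    (m : Fin k → (Fin n →₀ ℕ)) :
    IsJointlyHomogeneous w (tWeight w d m) (unfoldingPoly f₀ m) d :=
  (isJointlyHomogeneous_map_C (isWeightedHomogeneous_intWeight hf)).add
    (isJointlyHomogeneous_deformation w d m)

theorem exists_eq_of_coeff_deformation_ne_zero {α : Fin n →₀ ℕ}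
    (hα : coeff α (deformation m) ≠ 0) : ∃ j, m j = α := by
  classical
  rw [deformation, coeff_sum] at hα
  obtain ⟨j, _, hj⟩ := Finset.exists_ne_zero_of_sum_ne_zero hα
  rw [coeff_monomial] at hj
  exact ⟨j, (ite_ne_right_iff.1 hj).1⟩

/-- The error `∑ sᵢ ∂ᵢ(F - f₀)` made when `∑ sᵢ ∂ᵢf₀` is replaced by `∑ sᵢ ∂ᵢF`. -/
def divisionRemainder (m : Fin k → (Fin n →₀ ℕ)) (s : Fin n → MvPolynomial (Fin n) ℂ) :
    MvPolynomial (Fin n) (Base k) :=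
  ∑ i, map C (s i) * pderiv i (deformation m)

theorem map_C_sum_mul_pderiv (f₀ : MvPolynomial (Fin n) ℂ) (m : Fin k → (Fin n →₀ ℕ))
    (s : Fin n → MvPolynomial (Fin n) ℂ) :
    map C (∑ i, s i * pderiv i f₀) =
      ∑ i, map C (s i) * pderiv i (unfoldingPoly f₀ m) - divisionRemainder m s := by
  rw [map_sum, divisionRemainder, ← Finset.sum_sub_distrib]
  refine Finset.sum_congr rfl fun i _ => ?_
  rw [map_mul, unfoldingPoly_eq, map_add, ← mul_sub, add_sub_cancel_right, pderiv_map]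

section Remainder

variable {e : ℤ} {s : Fin n → MvPolynomial (Fin n) ℂ}

theorem isJointlyHomogeneous_divisionRemainder (m : Fin k → (Fin n →₀ ℕ))
    (hs : ∀ i, IsWeightedHomogeneous (intWeight w) (s i) (e - (d - w i))) :
    IsJointlyHomogeneous w (tWeight w d m) (divisionRemainder m s) e :=
  IsJointlyHomogeneous.sum fun i _ => by
    simpa only [sub_add_cancel] using
      (isJointlyHomogeneous_map_C (hs i)).mul ((isJointlyHomogeneous_deformation w d m).pderiv i)

theorem lt_weight_of_coeff_sum_mul_pderiv_ne_zero {q : MvPolynomial (Fin n) (Base k)}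
    (hq : ∀ α, coeff α q ≠ 0 → d < Finsupp.weight w α)
    (hs : ∀ i, IsWeightedHomogeneous (intWeight w) (s i) (e - (d - w i))) {α : Fin n →₀ ℕ}
    (hα : coeff α (∑ i, map C (s i) * pderiv i q) ≠ 0) : e < Finsupp.weight w α := by
  classical
  rw [coeff_sum] at hα
  obtain ⟨i, _, hi⟩ := Finset.exists_ne_zero_of_sum_ne_zero hα
  obtain ⟨β, hβ, γ, hγ, rfl⟩ := Finset.mem_add.1 (support_mul _ _ (mem_support_iff.2 hi))
  rw [mem_support_iff, coeff_map, Ne, C_eq_zero] at hβ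
  rw [mem_support_iff, coeff_pderiv] at hγ
  have hweightβ := hs i hβ
  have hweightγ := hq _ (left_ne_zero_of_mul hγ)
  rw [map_add, Finsupp.weight_single, one_smul] at hweightγ
  rw [weight_intWeight] at hweightβ
  rw [map_add]
  omega

theorem IsUpperUnfolding.lt_weight_of_coeff_deformation_ne_zero
    (D : IsUpperUnfolding w d f₀ B m M) {α : Fin n →₀ ℕ} (hα : coeff α (deformation m) ≠ 0) :
    d < Finsupp.weight w α := by
  obtain ⟨j, rfl⟩ := exists_eq_of_coeff_deformation_ne_zero hα
  exact (D.mem_and_lt_weight j).2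

theorem IsUpperUnfolding.lt_weight_of_coeff_divisionRemainder_ne_zero
    (D : IsUpperUnfolding w d f₀ B m M)
    (hs : ∀ i, IsWeightedHomogeneous (intWeight w) (s i) (e - (d - w i))) {α : Fin n →₀ ℕ}
    (hα : coeff α (divisionRemainder m s) ≠ 0) : e < Finsupp.weight w α :=
  lt_weight_of_coeff_sum_mul_pderiv_ne_zero
    (fun _ => D.lt_weight_of_coeff_deformation_ne_zero) hs hα

theorem polyToRel_map_C_mem_xIdeal (hw : ∀ i, 0 < w i)
    (hs : ∀ i, IsWeightedHomogeneous (intWeight w) (s i) (e - (d - w i))) (hde : d ≤ e)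
    (i : Fin n) : polyToRel n k (map C (s i)) ∈ xIdeal n k := by
  have hpos := hw i
  rw [mem_xIdeal_iff_coeff_zero, coe_polyToRel, coeff_coe, coeff_map,
    (hs i).coeff_eq_zero 0 (by rw [map_zero]; omega), C_0]

end Remainder

/-- The ideal `(x) (∂F/∂x₁, …, ∂F/∂xₙ)`. -/
def smallJacobian (f₀ : MvPolynomial (Fin n) ℂ) (m : Fin k → (Fin n →₀ ℕ)) :
    Ideal (RelSeries n k) := xIdeal n k * relJacobian f₀ m

theorem polyToRel_pderiv_mem (f₀ : MvPolynomial (Fin n) ℂ) (m : Fin k → (Fin n →₀ ℕ)) (i : Fin n) :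
    polyToRel n k (pderiv i (unfoldingPoly f₀ m)) ∈ relJacobian f₀ m :=
  Ideal.subset_span ⟨i, rfl⟩

namespace IsUpperUnfolding

/-- In weight at least `d` the quotients `sᵢ` have no constant term, so only the smaller ideal
`(x) (∂F/∂x₁, …, ∂F/∂xₙ)` is needed. -/
theorem polyToRel_sum_map_C_mul_pderiv_mem (D : IsUpperUnfolding w d f₀ B m M)
    {L : Ideal (RelSeries n k)} (hL : smallJacobian f₀ m ≤ L) {e : ℤ}
    {s : Fin n → MvPolynomial (Fin n) ℂ}
    (hs : ∀ i, IsWeightedHomogeneous (intWeight w) (s i) (e - (d - w i)))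
    (he : relJacobian f₀ m ≤ L ∨ d ≤ e) :
    polyToRel n k (∑ i, map C (s i) * pderiv i (unfoldingPoly f₀ m)) ∈ L := by
  rw [map_sum]
  refine Ideal.sum_mem _ fun i _ => ?_
  rw [map_mul]
  rcases he with he | he
  · exact Ideal.mul_mem_left _ _ (he (polyToRel_pderiv_mem f₀ m i))
  · exact hL (Ideal.mul_mem_mul (polyToRel_map_C_mem_xIdeal D.weight_pos hs he i)
      (polyToRel_pderiv_mem f₀ m i))

theorem exists_division [Fintype B] (D : IsUpperUnfolding w d f₀ B m M) (γ : Fin n →₀ ℕ) :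
    ∃ (c : B → ℂ) (s : Fin n → MvPolynomial (Fin n) ℂ),
      (∀ α : B, c α ≠ 0 → Finsupp.weight w (α : Fin n →₀ ℕ) = Finsupp.weight w γ) ∧
      (∀ i, IsWeightedHomogeneous (intWeight w) (s i) (Finsupp.weight w γ - (d - w i))) ∧
      (monomial γ 1 : MvPolynomial (Fin n) (Base k)) = ∑ α : B, monomial α.1 (C (c α)) +
        (∑ i, map C (s i) * pderiv i (unfoldingPoly f₀ m) - divisionRemainder m s) := by
  obtain ⟨c, s, hc, hs, h⟩ := D.basis.exists_division D.weight_pos D.homogeneous γ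
  refine ⟨c, s, hc, hs, ?_⟩
  rw [← C_1, ← map_monomial, h, map_add, map_sum, map_C_sum_mul_pderiv f₀ m]
  simp only [smul_monomial, map_monomial, smul_eq_mul, mul_one]

end IsUpperUnfolding

/-- A strict upper bound for `d` and for the weights of the basis monomials. -/
def weightBound (w : Fin n → ℕ) (d M : ℕ) : ℕ := M * ∑ i, w i + d + 1

theorem IsUpperUnfolding.weight_lt_weightBound (D : IsUpperUnfolding w d f₀ B m M)
    {α : Fin n →₀ ℕ} (hα : α ∈ B) : Finsupp.weight w α < weightBound w d M := by
  rw [Finsupp.weight_eq_sum, weightBound, Finset.mul_sum]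
  have : ∑ i, α i • w i ≤ ∑ i, M * w i :=
    Finset.sum_le_sum fun i _ => Nat.mul_le_mul_right _ (D.basis.lt_of_mem D.pow_mem hα i).le
  omega

/-- The ideal of `A₋[x]` generated by the monomials of weight at least `e`. -/
def weightIdeal (k : ℕ) (w : Fin n → ℕ) (e : ℕ) : Ideal (MvPolynomial (Fin n) (Base k)) :=
  Ideal.span ((fun γ => monomial γ 1) '' {γ | e ≤ Finsupp.weight w γ})

theorem mem_weightIdeal {p : MvPolynomial (Fin n) (Base k)} {e : ℕ}
    (hp : ∀ α, coeff α p ≠ 0 → e ≤ Finsupp.weight w α) : p ∈ weightIdeal k w e := by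
  rw [weightIdeal, mem_ideal_span_monomial_image]
  exact fun α hα => ⟨α, hp α (mem_support_iff.1 hα), le_rfl⟩

theorem map_weightIdeal_le_iff {e : ℕ} {L : Ideal (RelSeries n k)} :
    (weightIdeal k w e).map (polyToRel n k) ≤ L ↔
      ∀ γ, e ≤ Finsupp.weight w γ → polyToRel n k (monomial γ 1) ∈ L := by
  rw [weightIdeal, Ideal.map_span, Ideal.span_le, Set.image_image, Set.image_subset_iff]
  rfl

theorem exists_monomial_eq_X_mul {S : Type*} [CommSemiring S] {γ : Fin n →₀ ℕ} (hγ : γ ≠ 0) :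
    ∃ i γ', Finsupp.weight w γ = Finsupp.weight w γ' + w i ∧
      (monomial γ 1 : MvPolynomial (Fin n) S) = X i * monomial γ' 1 := by
  obtain ⟨i, hi⟩ := Finsupp.ne_iff.1 hγ
  refine ⟨i, γ - Finsupp.single i 1, (Finsupp.weight_sub_single_add hi).symm, ?_⟩
  rw [X, monomial_mul, one_mul, add_comm, tsub_add_cancel_of_le]
  rw [Finsupp.single_le_iff]
  exact Nat.one_le_iff_ne_zero.2 hi

theorem map_weightIdeal_add_le (e : ℕ) :
    (weightIdeal k w (e + (∑ i, w i + 1))).map (polyToRel n k) ≤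
      xIdeal n k • (weightIdeal k w e).map (polyToRel n k) := by
  refine map_weightIdeal_le_iff.2 fun γ hγ => ?_
  have hγ0 : γ ≠ 0 := by
    rintro rfl
    rw [map_zero] at hγ
    omega
  obtain ⟨i, γ', hweight, hmonomial⟩ := exists_monomial_eq_X_mul (w := w) (S := Base k) hγ0
  have hwi : w i ≤ ∑ i, w i :=
    Finset.single_le_sum (f := w) (fun _ _ => Nat.zero_le _) (Finset.mem_univ i)
  rw [hmonomial, map_mul]
  exact Ideal.mul_mem_mul (Ideal.subset_span ⟨i, rfl⟩)
    (map_weightIdeal_le_iff.1 le_rfl γ' (by omega))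

theorem xIdeal_pow_le_map_weightIdeal (hw : ∀ i, 0 < w i) (N : ℕ) :
    xIdeal n k ^ N ≤ (weightIdeal k w N).map (polyToRel n k) := by
  have hx : xIdeal n k = (idealOfVars (Fin n) (Base k)).map (polyToRel n k) := by
    rw [idealOfVars, Ideal.map_span, xIdeal, ← Set.range_comp]
    rfl
  rw [hx, ← Ideal.map_pow]
  refine Ideal.map_mono fun p hp => mem_weightIdeal fun α hα => ?_
  refine ((mem_pow_idealOfVars_iff N p).1 hp α (mem_support_iff.2 hα)).trans ?_
  rw [Finsupp.degree_eq_sum, Finsupp.weight_eq_sum]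
  exact Finset.sum_le_sum fun i _ => Nat.le_mul_of_pos_right _ (hw i)

namespace IsUpperUnfolding

theorem map_weightIdeal_le_succ (D : IsUpperUnfolding w d f₀ B m M) {e : ℕ}
    (he : weightBound w d M ≤ e) : (weightIdeal k w e).map (polyToRel n k) ≤
      smallJacobian f₀ m ⊔ (weightIdeal k w (e + 1)).map (polyToRel n k) := by
  have := D.finite.fintype
  refine map_weightIdeal_le_iff.2 fun γ hγ => ?_
  obtain ⟨c, s, hc, hs, h⟩ := D.exists_division γ
  have hc0 : ∀ α, c α = 0 := fun α => by
    by_contra hne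
    have := hc α hne
    have := D.weight_lt_weightBound α.2
    omega
  have hde : (d : ℤ) ≤ Finsupp.weight w γ := by
    rw [weightBound] at he
    omega
  simp only [h, hc0, map_zero, Finset.sum_const_zero, zero_add, map_sub]
  refine Ideal.sub_mem _
    (Ideal.mem_sup_left (D.polyToRel_sum_map_C_mul_pderiv_mem le_rfl hs (Or.inr hde)))
    (Ideal.mem_sup_right (Ideal.mem_map_of_mem _ (mem_weightIdeal fun α hα => ?_)))
  have := D.lt_weight_of_coeff_divisionRemainder_ne_zero hs hα
  omega

theorem map_weightIdeal_le_add (D : IsUpperUnfolding w d f₀ B m M) (N : ℕ) :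
    (weightIdeal k w (weightBound w d M)).map (polyToRel n k) ≤
      smallJacobian f₀ m ⊔ (weightIdeal k w (weightBound w d M + N)).map (polyToRel n k) := by
  induction N with
  | zero => exact le_sup_right
  | succ N ih =>
    exact ih.trans (sup_le le_sup_left (D.map_weightIdeal_le_succ (Nat.le_add_right _ _)))

theorem map_weightIdeal_le_smallJacobian (D : IsUpperUnfolding w d f₀ B m M) :
    (weightIdeal k w (weightBound w d M)).map (polyToRel n k) ≤ smallJacobian f₀ m :=
  Submodule.le_of_le_smul_of_le_jacobson_bot (Ideal.FG.map (IsNoetherian.noetherian _) _)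
    xIdeal_le_jacobson <| (D.map_weightIdeal_le_add (∑ i, w i + 1)).trans <|
      sup_le le_sup_left ((map_weightIdeal_add_le _).trans le_sup_right)

theorem xIdeal_pow_le_smallJacobian (D : IsUpperUnfolding w d f₀ B m M) :
    xIdeal n k ^ weightBound w d M ≤ smallJacobian f₀ m :=
  (xIdeal_pow_le_map_weightIdeal D.weight_pos _).trans D.map_weightIdeal_le_smallJacobian

end IsUpperUnfolding

end Division

section NormalForm

open MvPolynomial

variable {n k : ℕ} {B : Set (Fin n →₀ ℕ)} [Fintype B] {w : Fin n → ℕ} {v : Fin k → ℤ}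
  {L : Ideal (RelSeries n k)} {e e' : ℤ} {o o' : ℕ} {p q : MvPolynomial (Fin n) (Base k)}

/-- Modulo the ideal `L`, the polynomial `p` is a combination of the basis monomials of weight at
least `o`, with coefficients that make this combination homogeneous of degree `e`. -/
def HasNormalForm (B : Set (Fin n →₀ ℕ)) [Fintype B] (w : Fin n → ℕ) (v : Fin k → ℤ)
    (L : Ideal (RelSeries n k)) (e : ℤ) (o : ℕ) (p : MvPolynomial (Fin n) (Base k)) : Prop :=
  ∃ a : B → Base k, (∀ α : B, IsWeightedHomogeneous v (a α) (e - Finsupp.weight w α.1)) ∧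
    (∀ α : B, a α ≠ 0 → o ≤ Finsupp.weight w α.1) ∧
    polyToRel n k (p - ∑ α : B, monomial α.1 (a α)) ∈ L

namespace HasNormalForm

theorem of_mem (hp : polyToRel n k p ∈ L) : HasNormalForm B w v L e o p :=
  ⟨0, fun _ => isWeightedHomogeneous_zero _ _ _, fun _ h => absurd rfl h, by simpa using hp⟩

theorem add (hp : HasNormalForm B w v L e o p) (hq : HasNormalForm B w v L e o q) :
    HasNormalForm B w v L e o (p + q) := by
  obtain ⟨a, ha, hao, hpa⟩ := hp
  obtain ⟨b, hb, hbo, hqb⟩ := hq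
  refine ⟨a + b, fun α => (ha α).add (hb α), fun α hα => ?_, ?_⟩
  · by_cases h : a α = 0
    · exact hbo α fun h' => hα (by simp [h, h'])
    · exact hao α h
  · simp only [Pi.add_apply, map_add, Finset.sum_add_distrib]
    rw [add_sub_add_comm, map_add]
    exact Ideal.add_mem _ hpa hqb

theorem sum {ι : Type*} {s : Finset ι} {p : ι → MvPolynomial (Fin n) (Base k)}
    (hp : ∀ i ∈ s, HasNormalForm B w v L e o (p i)) :
    HasNormalForm B w v L e o (∑ i ∈ s, p i) :=
  Finset.sum_induction _ _ (fun _ _ => add) (of_mem (by rw [map_zero]; exact L.zero_mem)) hp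

theorem smul (hp : HasNormalForm B w v L e o p) (ho : o' ≤ o) {b : Base k}
    (hb : IsWeightedHomogeneous v b (e' - e)) : HasNormalForm B w v L e' o' (b • p) := by
  obtain ⟨a, ha, hao, hpa⟩ := hp
  refine ⟨b • a, fun α => ?_, fun α hα => ho.trans (hao α fun h => hα (by simp [h])), ?_⟩
  · have h := hb.mul (ha α)
    rwa [sub_add_sub_cancel] at h
  · have : b • p - ∑ α : B, monomial α.1 ((b • a) α) = b • (p - ∑ α : B, monomial α.1 (a α)) := by
      rw [smul_sub, Finset.smul_sum]
      simp only [Pi.smul_apply, smul_monomial]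
    rw [this, map_smul]
    exact Submodule.smul_of_tower_mem L b hpa

theorem of_monomials (hp : IsJointlyHomogeneous w v p e)
    (ho : ∀ α, coeff α p ≠ 0 → o ≤ Finsupp.weight w α)
    (h : ∀ α, coeff α p ≠ 0 →
      HasNormalForm B w v L (Finsupp.weight w α) (Finsupp.weight w α) (monomial α 1)) :
    HasNormalForm B w v L e o p := by
  rw [p.as_sum]
  refine sum fun α hα => ?_
  rw [mem_support_iff] at hα
  have : monomial α (coeff α p) = coeff α p • monomial α (1 : Base k) := by
    rw [smul_monomial, smul_eq_mul, mul_one]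
  rw [this]
  exact (h α hα).smul (ho α hα) (hp α)

theorem sum_monomial_C {c : B → ℂ}
    (hc : ∀ α : B, c α ≠ 0 → Finsupp.weight w (α : Fin n →₀ ℕ) = o) :
    HasNormalForm B w v L o o (∑ α : B, monomial α.1 (C (c α))) := by
  refine ⟨fun α => C (c α), fun α => ?_,
    fun α hα => (hc α fun h => hα (by simp only [h, C_0])).ge, ?_⟩
  · by_cases hcα : c α = 0
    · simp only [hcα, C_0]
      exact isWeightedHomogeneous_zero _ _ _
    · rw [hc α hcα, sub_self]
      exact isWeightedHomogeneous_C _ _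
  · rw [sub_self, map_zero]
    exact L.zero_mem

end HasNormalForm

variable {d : ℕ} {f₀ : MvPolynomial (Fin n) ℂ} {m : Fin k → (Fin n →₀ ℕ)} {M : ℕ}

theorem IsUpperUnfolding.hasNormalForm_monomial (D : IsUpperUnfolding w d f₀ B m M)
    (hL : smallJacobian f₀ m ≤ L) (γ : Fin n →₀ ℕ)
    (hγ : relJacobian f₀ m ≤ L ∨ d ≤ Finsupp.weight w γ) :
    HasNormalForm B w (tWeight w d m) L (Finsupp.weight w γ) (Finsupp.weight w γ)
      (monomial γ 1) := by
  induction hN : weightBound w d M - Finsupp.weight w γ using Nat.strong_induction_on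
    generalizing γ with
  | _ N ih =>
  subst hN
  by_cases hbig : weightBound w d M ≤ Finsupp.weight w γ
  · exact .of_mem (hL (map_weightIdeal_le_iff.1 D.map_weightIdeal_le_smallJacobian γ hbig))
  obtain ⟨c, s, hc, hs, h⟩ := D.exists_division γ
  have hquotient := D.polyToRel_sum_map_C_mul_pderiv_mem hL hs (hγ.imp_right Nat.cast_le.2)
  have hlt : ∀ α, coeff α (-divisionRemainder m s) ≠ 0 →
      Finsupp.weight w γ < Finsupp.weight w α := fun α hα => by
    rw [coeff_neg, neg_ne_zero] at hα
    exact Nat.cast_lt.1 (D.lt_weight_of_coeff_divisionRemainder_ne_zero hs hα)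
  rw [h, sub_eq_add_neg]
  refine (HasNormalForm.sum_monomial_C hc).add ((HasNormalForm.of_mem hquotient).add ?_)
  refine .of_monomials (isJointlyHomogeneous_divisionRemainder m hs).neg
    (fun α hα => (hlt α hα).le) fun α hα => ?_
  have := hlt α hα
  exact ih _ (by omega) α (hγ.imp_right this.le.trans') rfl

theorem IsUpperUnfolding.hasNormalForm (D : IsUpperUnfolding w d f₀ B m M)
    (hL : smallJacobian f₀ m ≤ L) (hp : IsJointlyHomogeneous w (tWeight w d m) p e)
    (ho : ∀ α, coeff α p ≠ 0 → o ≤ Finsupp.weight w α) (hLo : relJacobian f₀ m ≤ L ∨ d ≤ o) :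
    HasNormalForm B w (tWeight w d m) L e o p :=
  .of_monomials hp ho fun α hα =>
    D.hasNormalForm_monomial hL α (hLo.imp_right (ho α hα).trans')

end NormalForm

/-! ### The residue functional and the freeness of `I` -/

section Residue

open MvPolynomial

theorem isWeightedHomogeneous_det {σ ι S : Type*} [CommRing S] [Fintype ι] [DecidableEq ι]
    {v : σ → ℤ} (A : Matrix ι ι (MvPolynomial σ S)) (a b : ι → ℤ)
    (hA : ∀ i j, IsWeightedHomogeneous v (A i j) (a i + b j)) :
    IsWeightedHomogeneous v A.det (∑ i, a i + ∑ j, b j) := by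
  rw [Matrix.det_apply]
  refine IsWeightedHomogeneous.sum _ _ _ fun τ _ => ?_
  have h := IsWeightedHomogeneous.prod Finset.univ (fun i => A (τ i) i) _ fun i _ => hA (τ i) i
  rw [Finset.sum_add_distrib, Equiv.sum_comp τ a] at h
  rcases Int.units_eq_one_or (Equiv.Perm.sign τ) with hτ | hτ
  · rwa [hτ, one_smul]
  · rw [hτ, Units.neg_smul, one_smul]
    exact h.neg

variable {n k : ℕ}

section Functional

variable {R : Type*} [CommRing R] {M : ℕ}

/-- The exponent `(M - 1, …, M - 1)`, the socle degree of `(x₁^M, …, xₙ^M)`. -/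
def topExponent (n M : ℕ) : Fin n →₀ ℕ := Finsupp.equivFunOnFinite.symm fun _ => M - 1

theorem coeff_topExponent_mul_X_pow (hM : 0 < M) (g : MvPowerSeries (Fin n) R) (i : Fin n) :
    MvPowerSeries.coeff (topExponent n M) (g * MvPowerSeries.X i ^ M) = 0 := by
  classical
  rw [MvPowerSeries.X_pow_eq, MvPowerSeries.coeff_mul_monomial, if_neg]
  rw [Finsupp.single_le_iff, topExponent, Finsupp.equivFunOnFinite_symm_apply_apply]
  omega

/-- The functional `g ↦ coefficient of x^(M-1, …, M-1) in Δ g`. If `Δ` is the determinant of a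
matrix `A` with `A b = (x₁^M, …, xₙ^M)`, this is the Grothendieck residue of `g` along `b`. -/
def residue (M : ℕ) (Δ : MvPowerSeries (Fin n) R) : MvPowerSeries (Fin n) R →ₗ[R] R :=
  (MvPowerSeries.coeff (topExponent n M)).comp (LinearMap.mulLeft R Δ)

theorem residue_apply (Δ g : MvPowerSeries (Fin n) R) :
    residue M Δ g = MvPowerSeries.coeff (topExponent n M) (Δ * g) := rfl

theorem residue_comp_algHom (Δ : MvPowerSeries (Fin n) R) (p : MvPolynomial (Fin n) R) :
    (residue M Δ).comp (coeToMvPowerSeries.algHom R).toLinearMap p =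
      residue M Δ p.toMvPowerSeries := by
  rw [LinearMap.comp_apply, AlgHom.toLinearMap_apply, coeToMvPowerSeries.algHom_apply,
    Algebra.algebraMap_self, MvPowerSeries.map_id, RingHom.id_apply]

theorem map_residue {S : Type*} [CommRing S] (σ : R →+* S) (Δ g : MvPowerSeries (Fin n) R) :
    σ (residue M Δ g) = residue M (MvPowerSeries.map σ Δ) (MvPowerSeries.map σ g) := by
  rw [residue_apply, residue_apply, ← map_mul, MvPowerSeries.coeff_map]

theorem residue_eq_zero_of_mem {S : Type*} [CommRing S] (ι : S →+* MvPowerSeries (Fin n) R)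
    {A : Matrix (Fin n) (Fin n) S} {b : Fin n → S} (hM : 0 < M)
    (hA : ∀ i, ι (A.mulVec b i) = MvPowerSeries.X i ^ M) {g : S}
    (hg : g ∈ Ideal.span (Set.range b)) : residue M (ι A.det) (ι g) = 0 := by
  obtain ⟨c, rfl⟩ := (Submodule.mem_span_range_iff_exists_fun _).1 hg
  have hcramer : A.det • b = A.adjugate.mulVec (A.mulVec b) := by
    rw [Matrix.mulVec_mulVec, Matrix.adjugate_mul, Matrix.smul_mulVec, Matrix.one_mulVec]
  rw [map_sum, map_sum]
  refine Finset.sum_eq_zero fun j _ => ?_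
  have hj : A.det * b j = ∑ i, A.adjugate j i * A.mulVec b i := congrFun hcramer j
  rw [residue_apply, smul_eq_mul, ← map_mul, mul_left_comm, hj, Finset.mul_sum, map_sum, map_sum]
  refine Finset.sum_eq_zero fun i _ => ?_
  rw [← mul_assoc, map_mul, hA, coeff_topExponent_mul_X_pow hM]

theorem mem_span_of_residue_eq_zero {A : Matrix (Fin n) (Fin n) (MvPolynomial (Fin n) R)}
    {b : Fin n → MvPolynomial (Fin n) R} (hA : A.mulVec b = fun i => X i ^ M)
    {z : MvPolynomial (Fin n) R}
    (hz : ∀ α, residue M A.det.toMvPowerSeries (monomial α 1 * z).toMvPowerSeries = 0) :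
    z ∈ Ideal.span (Set.range b) := by
  classical
  refine mem_span_of_det_mul_mem hA (isWeaklyRegular_ofFn_X_pow M) ?_
  have himage : Set.range (fun i : Fin n => (X i ^ M : MvPolynomial (Fin n) R)) =
      (fun s => monomial s (1 : R)) '' Set.range fun j => Finsupp.single j M := by
    simp only [← Set.range_comp, Function.comp_def, X_pow_eq_monomial]
  rw [himage, mem_ideal_span_monomial_image]
  intro α hα
  by_contra! hlt
  have hle : α ≤ topExponent n M := fun i => by
    have := hlt _ ⟨i, rfl⟩
    rw [Finsupp.single_le_iff] at this
    rw [topExponent, Finsupp.equivFunOnFinite_symm_apply_apply]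
    omega
  have hcoeff := hz (topExponent n M - α)
  rw [residue_apply, ← coe_mul, coeff_coe, mul_left_comm, coeff_monomial_mul', if_pos tsub_le_self,
    one_mul, tsub_tsub_cancel_of_le hle] at hcoeff
  exact mem_support_iff.1 hα hcoeff

end Functional

/-- Specialization of a series to `t = 0`. -/
def specialize (n k : ℕ) : RelSeries n k →+* MvPowerSeries (Fin n) ℂ :=
  (MvPowerSeries.map (eval 0)).comp (toSeries n k).toRingHom

theorem specialize_polyToRel_map_C (p : MvPolynomial (Fin n) ℂ) :
    specialize n k (polyToRel n k (map C p)) = (p : MvPowerSeries (Fin n) ℂ) := by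
  ext α
  change MvPowerSeries.coeff α (MvPowerSeries.map (eval 0) (toSeries n k _)) = _
  rw [coe_polyToRel, MvPowerSeries.coeff_map, coeff_coe, coeff_coe, coeff_map, eval_C]

theorem specialize_algebraMap_X (l : Fin k) :
    specialize n k (algebraMap (Base k) (RelSeries n k) (X l)) = 0 := by
  change MvPowerSeries.map (eval 0) (toSeries n k _) = 0
  rw [AlgHom.commutes, ← MvPowerSeries.c_eq_algebraMap, MvPowerSeries.map_C, eval_X, Pi.zero_apply,
    map_zero]

variable {w : Fin n → ℕ} {d : ℕ} {f₀ : MvPolynomial (Fin n) ℂ} {B : Set (Fin n →₀ ℕ)}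
  {m : Fin k → (Fin n →₀ ℕ)} {M : ℕ}

theorem smallJacobian_le (f₀ : MvPolynomial (Fin n) ℂ) (m : Fin k → (Fin n →₀ ℕ)) :
    smallJacobian f₀ m ≤ relJacobian f₀ m := by
  rw [smallJacobian, Ideal.mul_le]
  exact fun _ _ _ hs => Ideal.mul_mem_left _ _ hs

theorem divisionRemainder_eq_sum_smul (m : Fin k → (Fin n →₀ ℕ))
    (s : Fin n → MvPolynomial (Fin n) ℂ) :
    divisionRemainder m s =
      ∑ l, (X l : Base k) • ∑ i, map C (s i) * pderiv i (monomial (m l) (1 : Base k)) := by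
  simp only [divisionRemainder, deformation, map_sum, Finset.mul_sum, Finset.smul_sum]
  rw [Finset.sum_comm]
  refine Finset.sum_congr rfl fun l _ => Finset.sum_congr rfl fun i _ => ?_
  rw [← mul_smul_comm, ← Derivation.map_smul, smul_monomial, smul_eq_mul, mul_one]

namespace IsUpperUnfolding

theorem polyToRel_divisionRemainder_mem (D : IsUpperUnfolding w d f₀ B m M) {e : ℤ}
    (he : weightBound w d M ≤ e) {s : Fin n → MvPolynomial (Fin n) ℂ}
    (hs : ∀ i, IsWeightedHomogeneous (intWeight w) (s i) (e - (d - w i))) :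
    polyToRel n k (divisionRemainder m s) ∈ RingHom.ker (specialize n k) * relJacobian f₀ m := by
  classical
  rw [divisionRemainder_eq_sum_smul, map_sum]
  refine Ideal.sum_mem _ fun l _ => ?_
  rw [map_smul, Algebra.smul_def]
  refine Ideal.mul_mem_mul (specialize_algebraMap_X l) (smallJacobian_le f₀ m
    (D.map_weightIdeal_le_smallJacobian (Ideal.mem_map_of_mem _ (mem_weightIdeal fun α hα => ?_))))
  have hlt := lt_weight_of_coeff_sum_mul_pderiv_ne_zero (fun β hβ => ?_) hs hα
  · omega
  · rw [coeff_monomial] at hβ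
    exact (ite_ne_right_iff.1 hβ).1 ▸ (D.mem_and_lt_weight l).2

theorem exists_lift (D : IsUpperUnfolding w d f₀ B m M) {e : ℤ} (he : weightBound w d M ≤ e)
    {s : Fin n → MvPolynomial (Fin n) ℂ}
    (hs : ∀ i, IsWeightedHomogeneous (intWeight w) (s i) (e - (d - w i))) :
    ∃ s' : Fin n → RelSeries n k,
      ∑ i, s' i * polyToRel n k (pderiv i (unfoldingPoly f₀ m)) =
        polyToRel n k (map C (∑ i, s i * pderiv i f₀)) ∧
      ∀ i, specialize n k (s' i) = s i := by
  have hmem := D.polyToRel_divisionRemainder_mem he hs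
  rw [relJacobian, ← smul_eq_mul, Submodule.mem_ideal_smul_span_iff_exists_sum] at hmem
  obtain ⟨a, ha, hsum⟩ := hmem
  replace hsum := (Finsupp.sum_fintype a (fun i c =>
    c • polyToRel n k (pderiv i (unfoldingPoly f₀ m))) fun _ => zero_smul _ _).symm.trans hsum
  refine ⟨fun i => polyToRel n k (map C (s i)) - a i, ?_, fun i => ?_⟩
  · rw [map_C_sum_mul_pderiv f₀ m, map_sub, ← hsum, map_sum]
    simp only [sub_mul, Finset.sum_sub_distrib, map_mul, smul_eq_mul]
  · rw [map_sub, specialize_polyToRel_map_C, (RingHom.mem_ker).1 (ha i), sub_zero]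

theorem X_pow_weightBound_mem (D : IsUpperUnfolding w d f₀ B m M) (i : Fin n) :
    (X i ^ weightBound w d M : MvPolynomial (Fin n) ℂ) ∈ polyJacobian f₀ := by
  refine Ideal.pow_mem_of_pow_mem _ (D.pow_mem i) ?_
  have hle : w i ≤ ∑ i, w i := Finset.single_le_sum (fun _ _ => Nat.zero_le _) (Finset.mem_univ i)
  have := Nat.le_mul_of_pos_right M ((D.weight_pos i).trans_le hle)
  rw [weightBound]
  omega

theorem exists_matrix (D : IsUpperUnfolding w d f₀ B m M) :
    ∃ A : Matrix (Fin n) (Fin n) (MvPolynomial (Fin n) ℂ),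
      (∀ i j, IsWeightedHomogeneous (intWeight w) (A i j)
        (↑(weightBound w d M * w i) - (d - w j))) ∧
      A.mulVec (fun j => pderiv j f₀) = fun i => X i ^ weightBound w d M := by
  have hhom (i : Fin n) : IsWeightedHomogeneous (intWeight w)
      (X i ^ weightBound w d M : MvPolynomial (Fin n) ℂ) ↑(weightBound w d M * w i) := by
    rw [X_pow_eq_monomial]
    refine isWeightedHomogeneous_monomial _ _ _ ?_
    rw [weight_intWeight, Finsupp.weight_single, smul_eq_mul]
  choose A hAhom hA using fun i => exists_homogeneous_eq_sum_of_mem_polyJacobian D.weight_pos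
    D.homogeneous (D.X_pow_weightBound_mem i) (hhom i)
  exact ⟨A, hAhom, funext fun i => (hA i).symm⟩

theorem exists_matrix_lift (D : IsUpperUnfolding w d f₀ B m M)
    {A : Matrix (Fin n) (Fin n) (MvPolynomial (Fin n) ℂ)}
    (hAhom : ∀ i j, IsWeightedHomogeneous (intWeight w) (A i j)
      (↑(weightBound w d M * w i) - (d - w j)))
    (hA : A.mulVec (fun j => pderiv j f₀) = fun i => X i ^ weightBound w d M) :
    ∃ A' : Matrix (Fin n) (Fin n) (RelSeries n k),
      (∀ i, A'.mulVec (fun j => polyToRel n k (pderiv j (unfoldingPoly f₀ m))) i =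
        polyToRel n k (X i ^ weightBound w d M)) ∧
      ∀ i j, specialize n k (A' i j) = A i j := by
  have hle (i : Fin n) : (weightBound w d M : ℤ) ≤ ↑(weightBound w d M * w i) :=
    Nat.cast_le.2 (Nat.le_mul_of_pos_right _ (D.weight_pos i))
  choose A' hA' hspecialize using fun i => D.exists_lift (hle i) (hAhom i)
  refine ⟨A', fun i => (hA' i).trans ?_, hspecialize⟩
  rw [show ∑ j, A i j * pderiv j f₀ = X i ^ weightBound w d M from congrFun hA i, map_pow, map_X]

end IsUpperUnfolding

/-- The class of a polynomial in the relative Milnor algebra. -/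
def relClass (f₀ : MvPolynomial (Fin n) ℂ) (m : Fin k → (Fin n →₀ ℕ)) :
    MvPolynomial (Fin n) (Base k) →ₐ[Base k] RelMilnorAlgebra f₀ m :=
  (Ideal.Quotient.mkₐ (Base k) (relJacobian f₀ m)).comp (polyToRel n k)

theorem relClass_apply (p : MvPolynomial (Fin n) (Base k)) :
    relClass f₀ m p = Ideal.Quotient.mk (relJacobian f₀ m) (polyToRel n k p) := rfl

theorem relClass_eq_iff {p q : MvPolynomial (Fin n) (Base k)} :
    relClass f₀ m p = relClass f₀ m q ↔ polyToRel n k (p - q) ∈ relJacobian f₀ m := by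
  rw [relClass_apply, relClass_apply, Ideal.Quotient.eq, map_sub]

theorem relClass_monomial (α : Fin n →₀ ℕ) (a : Base k) :
    relClass f₀ m (monomial α a) = a • relClass f₀ m (monomial α 1) := by
  rw [← map_smul, smul_monomial, smul_eq_mul, mul_one]

theorem relClass_sum_monomial [Fintype B] (a : B → Base k) :
    relClass f₀ m (∑ α : B, monomial α.1 (a α)) =
      ∑ α : B, a α • relClass f₀ m (monomial α.1 1) := by
  rw [map_sum]
  exact Finset.sum_congr rfl fun α _ => relClass_monomial _ _

/-- The residue functional on the relative Milnor algebra attached to a matrix `A` that expresses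
the `x_i^M` through the partial derivatives of `F`. -/
def relResidue (hM : 0 < M) {A : Matrix (Fin n) (Fin n) (RelSeries n k)}
    (hA : ∀ i, A.mulVec (fun j => polyToRel n k (pderiv j (unfoldingPoly f₀ m))) i =
      polyToRel n k (X i ^ M)) : RelMilnorAlgebra f₀ m →ₗ[Base k] Base k :=
  (((relJacobian f₀ m).restrictScalars (Base k)).liftQ
    ((residue M (toSeries n k A.det)).comp (toSeries n k).toLinearMap)
    fun _ hg => residue_eq_zero_of_mem (toSeries n k).toRingHom hM
      (fun i => by
        rw [hA]
        change toSeries n k (polyToRel n k _) = _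
        rw [coe_polyToRel, coe_pow, coe_X]) hg).comp
    (Submodule.Quotient.restrictScalarsEquiv (Base k) (relJacobian f₀ m)).symm.toLinearMap

/-- `φ` is a functional on the relative Milnor algebra whose specialization `φ₀` at `t = 0` is
homogeneous of degree `-δ` and induces a perfect pairing on the Milnor algebra of `f₀`. -/
structure IsResidue (w : Fin n → ℕ) (φ : RelMilnorAlgebra f₀ m →ₗ[Base k] Base k)
    (φ₀ : MvPolynomial (Fin n) ℂ →ₗ[ℂ] ℂ) (δ : ℤ) : Prop where
  eval_zero : ∀ p, eval 0 (φ (relClass f₀ m (map C p))) = φ₀ p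
  apply_eq_zero : ∀ p ∈ polyJacobian f₀, φ₀ p = 0
  weight_eq : ∀ α, φ₀ (monomial α 1) ≠ 0 → (Finsupp.weight w α : ℤ) = δ
  mem_polyJacobian : ∀ z, (∀ α, φ₀ (monomial α 1 * z) = 0) → z ∈ polyJacobian f₀

theorem exists_weight_eq_of_residue_ne_zero {A : Matrix (Fin n) (Fin n) (MvPolynomial (Fin n) ℂ)}
    {a b : Fin n → ℤ} (hA : ∀ i j, IsWeightedHomogeneous (intWeight w) (A i j) (a i + b j)) :
    ∃ δ : ℤ, ∀ α, residue M A.det.toMvPowerSeries (monomial α 1).toMvPowerSeries ≠ 0 →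
      (Finsupp.weight w α : ℤ) = δ := by
  refine ⟨Finsupp.weight w (topExponent n M) - (∑ i, a i + ∑ j, b j), fun α hα => ?_⟩
  rw [residue_apply, ← coe_mul, coeff_coe] at hα
  have h := (isWeightedHomogeneous_det A a b hA).mul
    (isWeightedHomogeneous_monomial (intWeight w) α (1 : ℂ) (weight_intWeight w α)) hα
  rw [weight_intWeight] at h
  omega

theorem IsUpperUnfolding.exists_isResidue (D : IsUpperUnfolding w d f₀ B m M) :
    ∃ (φ : RelMilnorAlgebra f₀ m →ₗ[Base k] Base k) (φ₀ : MvPolynomial (Fin n) ℂ →ₗ[ℂ] ℂ)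
      (δ : ℤ), IsResidue w φ φ₀ δ := by
  have hpos : 0 < weightBound w d M := Nat.succ_pos _
  obtain ⟨A, hAhom, hA⟩ := D.exists_matrix
  obtain ⟨A', hA', hspecialize⟩ := D.exists_matrix_lift hAhom hA
  obtain ⟨δ, hδ⟩ := exists_weight_eq_of_residue_ne_zero (M := weightBound w d M)
    (a := fun i => ↑(weightBound w d M * w i)) (b := fun j => -(d - w j)) fun i j => by
      rw [← sub_eq_add_neg]
      exact hAhom i j
  have hdet : specialize n k A'.det = (A.det : MvPolynomial (Fin n) ℂ) := by
    rw [← coeToMvPowerSeries.ringHom_apply, RingHom.map_det, RingHom.map_det]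
    exact congrArg Matrix.det (Matrix.ext hspecialize)
  refine ⟨relResidue hpos hA', (residue (weightBound w d M) A.det).comp
    (coeToMvPowerSeries.algHom ℂ).toLinearMap, δ, fun p => ?_, fun p hp => ?_, fun α hα => ?_,
    fun z hz => mem_span_of_residue_eq_zero hA ?_⟩
  · change eval 0 (residue _ (toSeries n k A'.det) (toSeries n k (polyToRel n k (map C p)))) = _
    rw [map_residue]
    change residue _ (specialize n k _) (specialize n k _) = _
    rw [hdet, specialize_polyToRel_map_C, residue_comp_algHom]
  · rw [residue_comp_algHom]
    refine residue_eq_zero_of_mem coeToMvPowerSeries.ringHom hpos (A := A)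
      (b := fun j => pderiv j f₀) (fun i => ?_) hp
    rw [hA, map_pow, coeToMvPowerSeries.ringHom_apply, coe_X]
  · rw [residue_comp_algHom] at hα
    exact hδ α hα
  · exact fun α => (residue_comp_algHom _ _).symm.trans (hz α)

theorem IsResidue.det_gram_ne_zero [Fintype B] [DecidableEq B] (D : IsUpperUnfolding w d f₀ B m M)
    {φ : RelMilnorAlgebra f₀ m →ₗ[Base k] Base k} {φ₀ : MvPolynomial (Fin n) ℂ →ₗ[ℂ] ℂ} {δ : ℤ}
    (hφ : IsResidue w φ φ₀ δ) :
    (Matrix.of fun β γ : B => φ₀ (monomial (β.1 + γ.1) 1)).det ≠ 0 := by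
  intro hdet
  obtain ⟨c, hc, hc0⟩ := Matrix.exists_mulVec_eq_zero_iff.2 hdet
  refine hc (D.basis.eq_zero_of_sum_mem (hφ.mem_polyJacobian _ fun α => ?_))
  set z := ∑ α : B, c α • monomial (α : Fin n →₀ ℕ) (1 : ℂ) with hz
  have hzero (β : B) : φ₀ (monomial β.1 1 * z) = 0 := by
    refine Eq.trans ?_ (congrFun hc0 β)
    rw [hz, Finset.mul_sum, map_sum]
    refine Finset.sum_congr rfl fun γ _ => ?_
    rw [mul_smul_comm, monomial_mul, one_mul, map_smul, smul_eq_mul, mul_comm]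
    rfl
  obtain ⟨c', s, -, -, h⟩ := D.basis.exists_division D.weight_pos D.homogeneous α
  rw [h, add_mul, map_add, Finset.sum_mul, map_sum, hφ.apply_eq_zero, add_zero]
  · refine Finset.sum_eq_zero fun β _ => ?_
    rw [smul_mul_assoc, map_smul, hzero, smul_zero]
  · exact Ideal.mul_mem_right _ _ (Ideal.sum_mem _ fun i _ =>
      Ideal.mul_mem_left _ _ (Ideal.subset_span ⟨i, rfl⟩))

theorem linearIndependent_of_det_ne_zero {R A ι : Type*} [CommRing R] [IsDomain R] [CommRing A]
    [Algebra R A] [Fintype ι] [DecidableEq ι] (φ : A →ₗ[R] R) {b : ι → A}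
    (hdet : (Matrix.of fun i j => φ (b i * b j)).det ≠ 0) : LinearIndependent R b := by
  refine Fintype.linearIndependent_iff.2 fun a ha => congrFun
    (Matrix.eq_zero_of_mulVec_eq_zero hdet (funext fun i => ?_))
  have h : φ (b i * ∑ j, a j • b j) = 0 := by rw [ha, mul_zero, map_zero]
  rw [Finset.mul_sum, map_sum] at h
  refine Eq.trans (Finset.sum_congr rfl fun j _ => ?_) h
  rw [mul_smul_comm, map_smul, smul_eq_mul, mul_comm]
  rfl

namespace IsUpperUnfolding

theorem relClass_surjective (D : IsUpperUnfolding w d f₀ B m M) :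
    Function.Surjective (relClass f₀ m) := by
  intro g
  obtain ⟨g, rfl⟩ := Ideal.Quotient.mk_surjective g
  obtain ⟨p, hp⟩ := exists_sub_polyToRel_mem_xIdeal_pow (weightBound w d M) g
  refine ⟨p, ?_⟩
  rw [relClass_apply, eq_comm, Ideal.Quotient.eq]
  exact smallJacobian_le f₀ m (D.xIdeal_pow_le_smallJacobian hp)

theorem linearIndependent (D : IsUpperUnfolding w d f₀ B m M) :
    LinearIndependent (Base k) fun α : B => relClass f₀ m (monomial α.1 1) := by
  classical
  have : Fintype B := D.finite.fintype
  obtain ⟨φ, φ₀, δ, hφ⟩ := D.exists_isResidue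
  refine linearIndependent_of_det_ne_zero φ fun hdet => hφ.det_gram_ne_zero D ?_
  refine Eq.trans ?_ ((congrArg (eval 0) hdet).trans (map_zero _))
  rw [RingHom.map_det]
  congr 1
  ext β γ
  change φ₀ (monomial (β.1 + γ.1) 1) = eval 0 (φ (relClass f₀ m _ * relClass f₀ m _))
  rw [← hφ.eval_zero, map_monomial, C_1, ← map_mul, monomial_mul, one_mul]

theorem span_eq_top (D : IsUpperUnfolding w d f₀ B m M) :
    ⊤ ≤ Submodule.span (Base k) (Set.range fun α : B => relClass f₀ m (monomial α.1 1)) := by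
  rintro g -
  have : Fintype B := D.finite.fintype
  obtain ⟨p, rfl⟩ := D.relClass_surjective g
  rw [p.as_sum, map_sum]
  refine Submodule.sum_mem _ fun γ _ => ?_
  rw [relClass_monomial]
  refine Submodule.smul_mem _ _ ?_
  obtain ⟨a, -, -, ha⟩ := D.hasNormalForm_monomial (smallJacobian_le f₀ m) γ (Or.inl le_rfl)
  rw [relClass_eq_iff.2 ha, relClass_sum_monomial]
  exact Submodule.sum_mem _ fun α _ => Submodule.smul_mem _ _ (Submodule.subset_span ⟨α, rfl⟩)

/-- The relative Milnor algebra is free over `A₋`, with the monomial basis of the Milnor algebra of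
`f₀` as a basis. -/
def relBasis (D : IsUpperUnfolding w d f₀ B m M) :
    Module.Basis B (Base k) (RelMilnorAlgebra f₀ m) :=
  Module.Basis.mk D.linearIndependent D.span_eq_top

theorem relBasis_apply (D : IsUpperUnfolding w d f₀ B m M) (α : B) :
    D.relBasis α = relClass f₀ m (monomial α.1 1) := by
  rw [relBasis, Module.Basis.mk_apply]

end IsUpperUnfolding

end Residue

/-! ### Dual bases and Euler's identity -/

section HomogeneousInverse

open MvPolynomial

variable {σ ι : Type*} {v : σ → ℤ}

theorem eq_C_of_isWeightedHomogeneous_zero {S : Type*} [CommSemiring S] (hv : ∀ j, v j < 0)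
    {p : MvPolynomial σ S} (hp : IsWeightedHomogeneous v p 0) : p = C (coeff 0 p) := by
  classical
  ext α
  rw [coeff_C]
  split_ifs with h
  · rw [h]
  · by_contra hne
    obtain ⟨j, hj⟩ := Finsupp.ne_iff.1 (Ne.symm h)
    have hle (i : σ) (_ : i ∈ α.support) : α i • v i ≤ 0 := by
      rw [nsmul_eq_mul]
      exact mul_nonpos_of_nonneg_of_nonpos (Nat.cast_nonneg _) (hv i).le
    have hsum : ∑ i ∈ α.support, α i • v i = 0 := by
      rw [← hp hne, Finsupp.weight_apply, Finsupp.sum]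
    have hzero := (Finset.sum_eq_zero_iff_of_nonpos hle).1 hsum j (Finsupp.mem_support_iff.2 hj)
    exact (smul_ne_zero hj (hv j).ne) hzero

variable [Fintype ι] [DecidableEq ι]

theorem isWeightedHomogeneous_adjugate {S : Type*} [CommRing S] {A : Matrix ι ι (MvPolynomial σ S)}
    {a b : ι → ℤ} (hA : ∀ i j, IsWeightedHomogeneous v (A i j) (a i + b j)) (i j : ι) :
    IsWeightedHomogeneous v (A.adjugate i j) (∑ i, a i + ∑ j, b j - (b i + a j)) := by
  rw [Matrix.adjugate_apply]
  have hrow (r c : ι) : IsWeightedHomogeneous v (A.updateRow j (Pi.single i 1) r c)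
      (Function.update a j (-b i) r + b c) := by
    rcases eq_or_ne r j with rfl | hr
    · rw [Matrix.updateRow_self, Function.update_self]
      rcases eq_or_ne c i with rfl | hc
      · rw [Pi.single_eq_same, neg_add_cancel]
        exact isWeightedHomogeneous_one _ _
      · rw [Pi.single_eq_of_ne hc]
        exact isWeightedHomogeneous_zero _ _ _
    · rw [Matrix.updateRow_ne hr, Function.update_of_ne hr]
      exact hA r c
  convert isWeightedHomogeneous_det _ _ _ hrow using 1
  rw [Finset.sum_update_of_mem (Finset.mem_univ j),
    Finset.sum_eq_add_sum_sdiff_singleton_of_mem (Finset.mem_univ j) a]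
  ring

theorem exists_homogeneous_mul_eq_one {K : Type*} [Field K] (hv : ∀ j, v j < 0)
    {A : Matrix ι ι (MvPolynomial σ K)} {a b : ι → ℤ}
    (hA : ∀ i j, IsWeightedHomogeneous v (A i j) (a i + b j)) (hdet : eval 0 A.det ≠ 0) :
    ∃ A' : Matrix ι ι (MvPolynomial σ K),
      (∀ i j, IsWeightedHomogeneous v (A' i j) (-(b i + a j))) ∧ A' * A = 1 := by
  rw [eval_zero, constantCoeff_eq] at hdet
  have hhom := isWeightedHomogeneous_det A a b hA
  have hdeg : ∑ i, a i + ∑ j, b j = 0 := by rw [← hhom hdet, map_zero]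
  rw [hdeg] at hhom
  refine ⟨(C (coeff 0 A.det)⁻¹ : MvPolynomial σ K) • A.adjugate, fun i j => ?_, ?_⟩
  · have h := isWeightedHomogeneous_adjugate hA i j
    rw [hdeg, zero_sub] at h
    exact h.C_mul _
  · rw [Matrix.smul_mul, Matrix.adjugate_mul, smul_smul,
      eq_C_of_isWeightedHomogeneous_zero hv hhom, coeff_zero_C, ← C_mul, inv_mul_cancel₀ hdet, C_1,
      one_smul]

end HomogeneousInverse

section Pairing

open MvPolynomial

variable {n k : ℕ} {w : Fin n → ℕ} {d : ℕ} {f₀ : MvPolynomial (Fin n) ℂ} {B : Set (Fin n →₀ ℕ)}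
  {m : Fin k → (Fin n →₀ ℕ)} {M : ℕ}

theorem IsUpperUnfolding.exists_normalForm [Fintype B] (D : IsUpperUnfolding w d f₀ B m M)
    {p : MvPolynomial (Fin n) (Base k)} {e : ℤ} (hp : IsJointlyHomogeneous w (tWeight w d m) p e) :
    ∃ a : B → Base k,
      (∀ α : B, IsWeightedHomogeneous (tWeight w d m) (a α) (e - Finsupp.weight w α.1)) ∧
      relClass f₀ m p = ∑ α : B, a α • relClass f₀ m (monomial α.1 1) := by
  obtain ⟨a, ha, -, h⟩ := D.hasNormalForm (L := relJacobian f₀ m) (o := 0) (smallJacobian_le f₀ m)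
    hp (fun _ _ => Nat.zero_le _) (Or.inl le_rfl)
  exact ⟨a, ha, (relClass_eq_iff.2 h).trans (relClass_sum_monomial a)⟩

theorem IsUpperUnfolding.tWeight_neg (D : IsUpperUnfolding w d f₀ B m M) (j : Fin k) :
    tWeight w d m j < 0 :=
  sub_neg.2 (Nat.cast_lt.2 (D.mem_and_lt_weight j).2)

/-- The functional on the relative Milnor algebra that takes the same values as `φ₀` on the monomial
basis. Unlike an arbitrary extension of `φ₀`, it is homogeneous whenever `φ₀` is. -/
def IsUpperUnfolding.extension (D : IsUpperUnfolding w d f₀ B m M)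
    (φ₀ : MvPolynomial (Fin n) ℂ →ₗ[ℂ] ℂ) : RelMilnorAlgebra f₀ m →ₗ[Base k] Base k :=
  D.relBasis.constr ℂ fun α => C (φ₀ (monomial α.1 1))

theorem IsUpperUnfolding.extension_monomial (D : IsUpperUnfolding w d f₀ B m M)
    (φ₀ : MvPolynomial (Fin n) ℂ →ₗ[ℂ] ℂ) (α : B) :
    D.extension φ₀ (relClass f₀ m (monomial α.1 1)) = C (φ₀ (monomial α.1 1)) := by
  rw [← D.relBasis_apply, extension, Module.Basis.constr_basis]

namespace IsResidue

variable {φ : RelMilnorAlgebra f₀ m →ₗ[Base k] Base k}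
  {φ₀ : MvPolynomial (Fin n) ℂ →ₗ[ℂ] ℂ} {δ : ℤ}

theorem eval_zero_extension (hφ : IsResidue w φ φ₀ δ) (D : IsUpperUnfolding w d f₀ B m M)
    (g : RelMilnorAlgebra f₀ m) : eval 0 (D.extension φ₀ g) = eval 0 (φ g) := by
  have : Fintype B := D.finite.fintype
  rw [← D.relBasis.sum_repr g]
  simp only [map_sum, map_smul, smul_eq_mul, map_mul, D.relBasis_apply, D.extension_monomial,
    eval_C]
  refine Finset.sum_congr rfl fun α _ => ?_
  rw [← hφ.eval_zero, map_monomial, C_1]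

theorem isWeightedHomogeneous_extension (hφ : IsResidue w φ φ₀ δ)
    (D : IsUpperUnfolding w d f₀ B m M) {p : MvPolynomial (Fin n) (Base k)} {e : ℤ}
    (hp : IsJointlyHomogeneous w (tWeight w d m) p e) :
    IsWeightedHomogeneous (tWeight w d m) (D.extension φ₀ (relClass f₀ m p)) (e - δ) := by
  have : Fintype B := D.finite.fintype
  obtain ⟨a, ha, h⟩ := D.exists_normalForm hp
  rw [h, map_sum]
  refine IsWeightedHomogeneous.sum _ _ _ fun α _ => ?_
  rw [map_smul, D.extension_monomial, smul_eq_mul, mul_comm]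
  by_cases hα : φ₀ (monomial α.1 1) = 0
  · rw [hα, C_0, zero_mul]
    exact isWeightedHomogeneous_zero _ _ _
  · rw [← hφ.weight_eq _ hα]
    exact (ha α).C_mul _

end IsResidue

/-- `ψ` is a homogeneous functional of degree `-δ` on the relative Milnor algebra, and the classes
of the `N β` form the basis dual to the monomial basis `B` for the pairing `(g, h) ↦ ψ (g h)`. -/
structure IsDualBasis [DecidableEq B] (w : Fin n → ℕ) (d : ℕ)
    (ψ : RelMilnorAlgebra f₀ m →ₗ[Base k] Base k) (δ : ℤ)
    (N : B → MvPolynomial (Fin n) (Base k)) : Prop where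
  isWeightedHomogeneous_apply : ∀ p e, IsJointlyHomogeneous w (tWeight w d m) p e →
    IsWeightedHomogeneous (tWeight w d m) (ψ (relClass f₀ m p)) (e - δ)
  isJointlyHomogeneous : ∀ β : B,
    IsJointlyHomogeneous w (tWeight w d m) (N β) (δ - Finsupp.weight w β.1)
  apply_mul : ∀ β γ : B, ψ (relClass f₀ m (N β) * relClass f₀ m (monomial γ.1 1)) =
    if β = γ then 1 else 0

theorem isJointlyHomogeneous_monomial_one (w : Fin n → ℕ) (v : Fin k → ℤ) (α : Fin n →₀ ℕ) :
    IsJointlyHomogeneous w v (monomial α 1) (Finsupp.weight w α) := by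
  have h := isJointlyHomogeneous_monomial (w := w) (isWeightedHomogeneous_one ℂ v) α
  rwa [zero_add] at h

theorem IsUpperUnfolding.exists_isDualBasis [DecidableEq B]
    (D : IsUpperUnfolding w d f₀ B m M) :
    ∃ (ψ : RelMilnorAlgebra f₀ m →ₗ[Base k] Base k) (δ : ℤ)
      (N : B → MvPolynomial (Fin n) (Base k)), IsDualBasis w d ψ δ N := by
  have : Fintype B := D.finite.fintype
  obtain ⟨φ, φ₀, δ, hφ⟩ := D.exists_isResidue
  set G : Matrix B B (Base k) :=
    Matrix.of fun β γ => D.extension φ₀ (relClass f₀ m (monomial (β.1 + γ.1) 1))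
  have hGhom (β γ : B) : IsWeightedHomogeneous (tWeight w d m) (G β γ)
      (Finsupp.weight w β.1 + (Finsupp.weight w γ.1 - δ)) := by
    have h := hφ.isWeightedHomogeneous_extension D
      (isJointlyHomogeneous_monomial_one w _ (β.1 + γ.1))
    rwa [map_add, Nat.cast_add, add_sub_assoc] at h
  have hdet : eval 0 G.det ≠ 0 := by
    rw [RingHom.map_det]
    convert hφ.det_gram_ne_zero D using 3
    ext β γ
    change eval 0 (D.extension φ₀ (relClass f₀ m (monomial (β.1 + γ.1) 1))) = _
    rw [hφ.eval_zero_extension, Matrix.of_apply, ← hφ.eval_zero, map_monomial, C_1]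
  obtain ⟨H, hHhom, hHG⟩ := exists_homogeneous_mul_eq_one D.tWeight_neg hGhom hdet
  refine ⟨D.extension φ₀, δ, fun β => ∑ η : B, monomial η.1 (H β η),
    fun p e => hφ.isWeightedHomogeneous_extension D, fun β => ?_, fun β γ => ?_⟩
  · refine IsJointlyHomogeneous.sum fun η _ => ?_
    convert isJointlyHomogeneous_monomial (hHhom β η) η.1 using 1
    ring
  · rw [← Matrix.one_apply, ← hHG, Matrix.mul_apply, relClass_sum_monomial, Finset.sum_mul, map_sum]
    refine Finset.sum_congr rfl fun η _ => ?_
    rw [smul_mul_assoc, map_smul, ← map_mul, monomial_mul, one_mul, smul_eq_mul]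
    rfl

namespace IsDualBasis

variable [DecidableEq B] {ψ : RelMilnorAlgebra f₀ m →ₗ[Base k] Base k} {δ : ℤ}
  {N : B → MvPolynomial (Fin n) (Base k)}

theorem apply_sum_mul [Fintype B] (E : IsDualBasis w d ψ δ N) (c : B → Base k) (β : B) :
    ψ ((∑ γ : B, c γ • relClass f₀ m (monomial γ.1 1)) * relClass f₀ m (N β)) = c β := by
  rw [mul_comm]
  simp only [Finset.mul_sum, map_sum, mul_smul_comm, map_smul, E.apply_mul, smul_eq_mul, mul_ite,
    mul_one, mul_zero, Finset.sum_ite_eq, Finset.mem_univ, if_true]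

theorem eq_sum_monomial [Fintype B] (E : IsDualBasis w d ψ δ N) (D : IsUpperUnfolding w d f₀ B m M)
    (g : RelMilnorAlgebra f₀ m) :
    g = ∑ γ : B, ψ (g * relClass f₀ m (N γ)) • relClass f₀ m (monomial γ.1 1) := by
  have hsum : ∑ γ : B, D.relBasis.repr g γ • relClass f₀ m (monomial γ.1 1) = g := by
    simp only [← D.relBasis_apply]
    exact D.relBasis.sum_repr g
  have hcoeff (γ : B) : ψ (g * relClass f₀ m (N γ)) = D.relBasis.repr g γ :=
    (congrArg (fun g => ψ (g * relClass f₀ m (N γ))) hsum.symm).trans (E.apply_sum_mul _ γ)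
  simp only [hcoeff]
  exact hsum.symm

theorem eq_of_apply_mul_monomial_eq (E : IsDualBasis w d ψ δ N)
    (D : IsUpperUnfolding w d f₀ B m M) {g h : RelMilnorAlgebra f₀ m}
    (hgh : ∀ γ : B, ψ (g * relClass f₀ m (monomial γ.1 1)) =
      ψ (h * relClass f₀ m (monomial γ.1 1))) : g = h := by
  have : Fintype B := D.finite.fintype
  have hmul (y : RelMilnorAlgebra f₀ m) : ψ (g * y) = ψ (h * y) := by
    rw [E.eq_sum_monomial D y]
    simp only [Finset.mul_sum, map_sum, mul_smul_comm, map_smul, hgh]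
  rw [E.eq_sum_monomial D g, E.eq_sum_monomial D h]
  simp only [hmul]

theorem eq_sum_dual [Fintype B] (E : IsDualBasis w d ψ δ N) (D : IsUpperUnfolding w d f₀ B m M)
    (g : RelMilnorAlgebra f₀ m) :
    g = ∑ β : B, ψ (g * relClass f₀ m (monomial β.1 1)) • relClass f₀ m (N β) := by
  refine E.eq_of_apply_mul_monomial_eq D fun γ => ?_
  simp only [Finset.sum_mul, map_sum, smul_mul_assoc, map_smul, E.apply_mul, smul_eq_mul, mul_ite,
    mul_one, mul_zero, Finset.sum_ite_eq', Finset.mem_univ, if_true]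

end IsDualBasis

end Pairing

section UpperMultiples

open MvPolynomial

variable {n k : ℕ} {w : Fin n → ℕ} {d : ℕ} {f₀ : MvPolynomial (Fin n) ℂ} {B : Set (Fin n →₀ ℕ)}
  {m : Fin k → (Fin n →₀ ℕ)} {M : ℕ}

/-- The part of `F` that is not in its own Jacobian ideal by Euler's identity: for `d ≠ 0`,
`F - ∑ j, (1 - deg m_j / d) t_j m_j = d⁻¹ ∑ i, w_i x_i ∂F/∂x_i`. -/
def eulerRemainder (w : Fin n → ℕ) (d : ℕ) (m : Fin k → (Fin n →₀ ℕ)) :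
    MvPolynomial (Fin n) (Base k) :=
  ∑ j, monomial (m j) (C ((tWeight w d m j : ℂ) / d) * X j)

theorem isJointlyHomogeneous_eulerRemainder :
    IsJointlyHomogeneous w (tWeight w d m) (eulerRemainder w d m) d := by
  refine IsJointlyHomogeneous.sum fun j _ => ?_
  convert isJointlyHomogeneous_monomial ((isWeightedHomogeneous_X ℂ (tWeight w d m) j).C_mul
    ((tWeight w d m j : ℂ) / d)) (m j) using 1
  exact (sub_add_cancel _ _).symm

theorem IsUpperUnfolding.lt_weight_of_coeff_eulerRemainder_ne_zero
    (D : IsUpperUnfolding w d f₀ B m M) {α : Fin n →₀ ℕ} (hα : coeff α (eulerRemainder w d m) ≠ 0) :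
    d < Finsupp.weight w α := by
  rw [eulerRemainder, coeff_sum] at hα
  obtain ⟨j, -, hj⟩ := Finset.exists_ne_zero_of_sum_ne_zero hα
  rw [coeff_monomial, ne_eq, ite_eq_right_iff, Classical.not_imp] at hj
  exact hj.1 ▸ (D.mem_and_lt_weight j).2

theorem sum_weight_X_mul_pderiv_unfoldingPoly (hf : IsWeightedHomogeneous w f₀ d) (hd : d ≠ 0) :
    ∑ i, w i • (X i * pderiv i (unfoldingPoly f₀ m)) =
      (d : Base k) • (unfoldingPoly f₀ m - eulerRemainder w d m) := by
  have hf' : IsWeightedHomogeneous w (map C f₀ : MvPolynomial (Fin n) (Base k)) d :=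
    fun α hα => hf fun h => hα (by rw [coeff_map, h, C_0])
  have hmono (j : Fin k) : ∑ i, w i • (X i * pderiv i (monomial (m j) (X j : Base k))) =
      Finsupp.weight w (m j) • monomial (m j) (X j : Base k) :=
    (isWeightedHomogeneous_monomial w (m j) (X j : Base k) rfl).sum_weight_X_mul_pderiv
  have hcoeff (j : Fin k) : (d : Base k) * C ((tWeight w d m j : ℂ) / d) =
      (d : Base k) - ((Finsupp.weight w (m j) : ℕ) : Base k) := by
    rw [← map_natCast (C : ℂ →+* Base k) d, ← map_mul, mul_div_cancel₀ _ (Nat.cast_ne_zero.2 hd),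
      tWeight, Int.cast_sub, Int.cast_natCast, Int.cast_natCast, map_sub, map_natCast, map_natCast]
  have hremainder : (d : Base k) • eulerRemainder w d m =
      ∑ j, (d • monomial (m j) (X j) - Finsupp.weight w (m j) • monomial (m j) (X j)) := by
    rw [eulerRemainder, Finset.smul_sum]
    refine Finset.sum_congr rfl fun j _ => ?_
    rw [smul_monomial, smul_eq_mul, ← mul_assoc, hcoeff, sub_mul, map_sub, ← nsmul_eq_mul,
      ← nsmul_eq_mul, map_nsmul, map_nsmul]
  rw [smul_sub, hremainder]
  simp only [unfoldingPoly, map_add, map_sum, mul_add, smul_add, Finset.sum_add_distrib,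
    Finset.mul_sum, Finset.smul_sum, hf'.sum_weight_X_mul_pderiv, Nat.cast_smul_eq_nsmul,
    Finset.sum_sub_distrib]
  rw [Finset.sum_comm]
  simp only [hmono]
  abel

theorem relClass_unfoldingPoly (hf : IsWeightedHomogeneous w f₀ d) (hd : d ≠ 0) :
    relClass f₀ m (unfoldingPoly f₀ m) = relClass f₀ m (eulerRemainder w d m) := by
  have hunit : IsUnit (d : Base k) := by
    rw [← map_natCast (C : ℂ →+* Base k) d]
    exact (IsUnit.mk0 _ (Nat.cast_ne_zero.2 hd)).map C
  rw [← hunit.smul_left_cancel, ← map_smul, ← map_smul, relClass_eq_iff, ← smul_sub,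
    ← sum_weight_X_mul_pderiv_unfoldingPoly hf hd, map_sum]
  refine Ideal.sum_mem _ fun i _ => ?_
  rw [map_nsmul, map_mul]
  exact nsmul_mem (Ideal.mul_mem_left _ _ (polyToRel_pderiv_mem f₀ m i)) _

theorem le_weight_of_coeff_mul_ne_zero {S : Type*} [CommSemiring S] {o : ℕ}
    {p q : MvPolynomial (Fin n) S} (hq : ∀ α, coeff α q ≠ 0 → o ≤ Finsupp.weight w α)
    {α : Fin n →₀ ℕ} (hα : coeff α (p * q) ≠ 0) : o ≤ Finsupp.weight w α := by
  classical
  obtain ⟨β, -, γ, hγ, rfl⟩ := Finset.mem_add.1 (support_mul _ _ (mem_support_iff.2 hα))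
  rw [map_add]
  exact (hq γ (mem_support_iff.1 hγ)).trans le_add_self

namespace IsUpperUnfolding

variable (D : IsUpperUnfolding w d f₀ B m M)
include D

theorem le_weight_of_coeff_unfoldingPoly_ne_zero {α : Fin n →₀ ℕ}
    (hα : coeff α (unfoldingPoly f₀ m) ≠ 0) : d ≤ Finsupp.weight w α := by
  rw [unfoldingPoly_eq, coeff_add] at hα
  by_cases h : coeff α (deformation m) = 0
  · rw [h, add_zero, coeff_map] at hα
    exact (D.homogeneous fun h => hα (by rw [h, C_0])).ge
  · exact (D.lt_weight_of_coeff_deformation_ne_zero h).le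

/-- The index of the upper monomial `m j` in the monomial basis `B`. -/
def index (j : Fin k) : B := ⟨m j, (D.mem_and_lt_weight j).1⟩

theorem index_injective : Function.Injective D.index :=
  fun _ _ h => D.upper.injective (congrArg Subtype.val h)

theorem weight_le_of_notMem {γ : B} (hγ : γ ∉ Set.range D.index) : Finsupp.weight w γ.1 ≤ d := by
  by_contra! h
  obtain ⟨j, hj⟩ : γ.1 ∈ Set.range m := D.upper.range_eq ▸ ⟨γ.2, h⟩
  exact hγ ⟨j, Subtype.ext hj⟩

end IsUpperUnfolding

/-- The matrix `h_{ij} = ψ (N_{k-i+1} F N_j)` of coefficients of `n_i F`, where `n_i = N_{k-i+1}`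
and `N_j` is dual to the upper monomial `m_j`. The reversal of `i` turns the symmetry of the pairing
into symmetry about the antidiagonal. -/
def coeffMatrix (D : IsUpperUnfolding w d f₀ B m M) (ψ : RelMilnorAlgebra f₀ m →ₗ[Base k] Base k)
    (N : B → MvPolynomial (Fin n) (Base k)) (i j : Fin k) : Base k :=
  ψ (relClass f₀ m (N (D.index i.rev)) * relClass f₀ m (unfoldingPoly f₀ m) *
    relClass f₀ m (N (D.index j)))

theorem coeffMatrix_symm (D : IsUpperUnfolding w d f₀ B m M)
    (ψ : RelMilnorAlgebra f₀ m →ₗ[Base k] Base k) (N : B → MvPolynomial (Fin n) (Base k))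
    (i j : Fin k) : coeffMatrix D ψ N i j = coeffMatrix D ψ N j.rev i.rev := by
  rw [coeffMatrix, coeffMatrix, Fin.rev_rev, mul_right_comm,
    mul_comm (relClass f₀ m (N (D.index i.rev))), mul_right_comm]

namespace IsDualBasis

variable [DecidableEq B] {ψ : RelMilnorAlgebra f₀ m →ₗ[Base k] Base k} {δ : ℤ}
  {N : B → MvPolynomial (Fin n) (Base k)}

theorem isWeightedHomogeneous_coeffMatrix (E : IsDualBasis w d ψ δ N)
    (D : IsUpperUnfolding w d f₀ B m M) (i j : Fin k) :
    IsWeightedHomogeneous (tWeight w d m) (coeffMatrix D ψ N i j)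
      (tWeight w d m j + (δ - Finsupp.weight w (m i.rev))) := by
  rw [coeffMatrix, ← map_mul, ← map_mul]
  convert E.isWeightedHomogeneous_apply _ _ (((E.isJointlyHomogeneous (D.index i.rev)).mul
    (isJointlyHomogeneous_unfoldingPoly D.homogeneous m)).mul
      (E.isJointlyHomogeneous (D.index j))) using 1
  simp only [tWeight, IsUpperUnfolding.index]
  ring

-- Modulo the Jacobian ideal `F` only involves monomials of weight `> d`, and so do its multiples.
theorem apply_mul_unfoldingPoly_eq_zero (E : IsDualBasis w d ψ δ N)
    (D : IsUpperUnfolding w d f₀ B m M) {p : MvPolynomial (Fin n) (Base k)} {e : ℤ}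
    (hp : IsJointlyHomogeneous w (tWeight w d m) p e) {γ : B} (hγ : Finsupp.weight w γ.1 ≤ d) :
    ψ (relClass f₀ m p * relClass f₀ m (unfoldingPoly f₀ m) * relClass f₀ m (N γ)) = 0 := by
  have : Fintype B := D.finite.fintype
  obtain ⟨a, -, ha, h⟩ := D.hasNormalForm (o := d + 1) (smallJacobian_le f₀ m)
    (hp.mul isJointlyHomogeneous_eulerRemainder) (fun α => le_weight_of_coeff_mul_ne_zero
      fun β hβ => D.lt_weight_of_coeff_eulerRemainder_ne_zero hβ) (Or.inl le_rfl)
  rw [relClass_unfoldingPoly D.homogeneous D.degree_ne_zero, ← map_mul, relClass_eq_iff.2 h,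
    relClass_sum_monomial, E.apply_sum_mul]
  by_contra hne
  exact hγ.not_gt (ha γ hne)

theorem mul_unfoldingPoly_eq (E : IsDualBasis w d ψ δ N) (D : IsUpperUnfolding w d f₀ B m M)
    (i : Fin k) : relClass f₀ m (N (D.index i.rev)) * relClass f₀ m (unfoldingPoly f₀ m) =
      ∑ j, coeffMatrix D ψ N i j • relClass f₀ m (monomial (m j) 1) := by
  have : Fintype B := D.finite.fintype
  refine (E.eq_sum_monomial D _).trans (Fintype.sum_of_injective D.index D.index_injective _ _
    (fun γ hγ => ?_) fun j => rfl).symm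
  rw [E.apply_mul_unfoldingPoly_eq_zero D (E.isJointlyHomogeneous _) (D.weight_le_of_notMem hγ),
    zero_smul]

theorem mul_unfoldingPoly_eq_zero (E : IsDualBasis w d ψ δ N) (D : IsUpperUnfolding w d f₀ B m M)
    {β : B} (hβ : β ∉ Set.range D.index) :
    relClass f₀ m (N β) * relClass f₀ m (unfoldingPoly f₀ m) = 0 := by
  have : Fintype B := D.finite.fintype
  refine (E.eq_sum_monomial D _).trans (Finset.sum_eq_zero fun γ _ => ?_)
  rw [mul_rotate, mul_comm (relClass f₀ m (unfoldingPoly f₀ m)),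
    E.apply_mul_unfoldingPoly_eq_zero D (E.isJointlyHomogeneous _) (D.weight_le_of_notMem hβ),
    zero_smul]

theorem mul_unfoldingPoly_sub_mem (E : IsDualBasis w d ψ δ N) (D : IsUpperUnfolding w d f₀ B m M)
    (i : Fin k) :
    polyToRel n k (N (D.index i.rev)) * unfolding f₀ m -
      ∑ j, coeffMatrix D ψ N i j • upperMonomial m j ∈ smallJacobian f₀ m := by
  have : Fintype B := D.finite.fintype
  obtain ⟨a, -, -, h⟩ := D.hasNormalForm (L := smallJacobian f₀ m) (o := d) le_rfl
    ((E.isJointlyHomogeneous (D.index i.rev)).mul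
      (isJointlyHomogeneous_unfoldingPoly D.homogeneous m))
    (fun α => le_weight_of_coeff_mul_ne_zero fun β =>
      D.le_weight_of_coeff_unfoldingPoly_ne_zero) (Or.inr le_rfl)
  have hclass := relClass_eq_iff.2 (smallJacobian_le f₀ m h)
  rw [relClass_sum_monomial, map_mul] at hclass
  have ha (γ : B) : a γ = ψ (relClass f₀ m (N (D.index i.rev)) *
      relClass f₀ m (unfoldingPoly f₀ m) * relClass f₀ m (N γ)) := by
    rw [hclass, E.apply_sum_mul]
  have hsum : ∑ α : B, (monomial α.1 (a α) : MvPolynomial (Fin n) (Base k)) =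
      ∑ j, coeffMatrix D ψ N i j • monomial (m j) 1 := by
    refine (Fintype.sum_of_injective D.index D.index_injective _ _ (fun γ hγ => ?_)
      fun j => ?_).symm
    · rw [ha, E.apply_mul_unfoldingPoly_eq_zero D (E.isJointlyHomogeneous _)
        (D.weight_le_of_notMem hγ), map_zero]
    · rw [ha, smul_monomial, smul_eq_mul, mul_one]
      rfl
  rw [hsum, map_sub, map_mul, map_sum] at h
  simp only [map_smul] at h
  exact h

end IsDualBasis

end UpperMultiples

/-! ### The kernel of the Kodaira–Spencer map -/

section VectorFields

open MvPolynomial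

variable {k : ℕ}

theorem derivation_sum_apply {ι R A P : Type*} [CommSemiring R] [CommSemiring A] [Algebra R A]
    [AddCommMonoid P] [Module A P] [Module R P] (s : Finset ι) (θ : ι → Derivation R A P) (a : A) :
    (∑ i ∈ s, θ i) a = ∑ i ∈ s, θ i a := by
  have h := map_sum (Derivation.coeFnAddMonoidHom (R := R) (A := A) (M := P)) θ s
  exact (congrFun h a).trans (Finset.sum_apply _ _ _)

theorem vectorField_apply (h : Fin k → Base k) (p : Base k) :
    vectorField h p = ∑ j, h j * pderiv j p := by
  rw [vectorField, derivation_sum_apply]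
  rfl

theorem vectorField_X (h : Fin k → Base k) (j : Fin k) : vectorField h (X j) = h j := by
  simp only [vectorField_apply, pderiv_X, Pi.single_apply, mul_ite, mul_one, mul_zero,
    Finset.sum_ite_eq, Finset.mem_univ, if_true]

theorem derivation_eq_sum_smul_vectorField {ι : Type*} [Fintype ι] {c : ι → Base k}
    {h : ι → Fin k → Base k} {θ : Derivation ℂ (Base k) (Base k)}
    (hθ : ∀ j, θ (X j) = ∑ i, c i * h i j) : θ = ∑ i, c i • vectorField (h i) := by
  refine derivation_ext fun j => ?_
  simp only [hθ, derivation_sum_apply, Derivation.smul_apply, vectorField_X, smul_eq_mul]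

theorem isHomogeneousField_vectorField {v : Fin k → ℤ} {h : Fin k → Base k} {e : ℤ}
    (hh : ∀ j, IsWeightedHomogeneous v (h j) (v j + e)) :
    IsHomogeneousField v (vectorField h) e := by
  intro p a hp
  rw [vectorField_apply]
  refine IsWeightedHomogeneous.sum _ _ _ fun j _ => ?_
  convert (hh j).mul (hp.pderiv (i := j) (sub_add_cancel a (v j))) using 1
  ring

end VectorFields

section Kernel

open MvPolynomial

variable {n k : ℕ} {w : Fin n → ℕ} {d : ℕ} {f₀ : MvPolynomial (Fin n) ℂ} {B : Set (Fin n →₀ ℕ)}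
  {m : Fin k → (Fin n →₀ ℕ)} {M : ℕ}

theorem mem_ker_kodairaSpencer (hm : ∀ j, m j ≠ 0) (θ : Derivation ℂ (Base k) (Base k)) :
    θ ∈ LinearMap.ker (kodairaSpencer f₀ m hm) ↔ derivUnfolding m θ ∈ ksIdeal f₀ m := by
  rw [LinearMap.mem_ker]
  exact Submodule.Quotient.mk_eq_zero _

theorem derivUnfolding_vectorField (h : Fin k → Base k) :
    derivUnfolding m (vectorField h) =
      (∑ j, h j • upperMonomial m j : RelSeries n k) := by
  change ∑ j, vectorField h (X j) • upperMonomial m j = _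
  simp only [vectorField_X]

theorem IsUpperUnfolding.eq_of_sum_smul_eq (D : IsUpperUnfolding w d f₀ B m M)
    {a b : Fin k → Base k} (h : ∑ j, a j • relClass f₀ m (monomial (m j) 1) =
      ∑ j, b j • relClass f₀ m (monomial (m j) 1)) : a = b :=
  (D.linearIndependent.comp D.index D.index_injective).fintypeLinearCombination_injective h

theorem exists_mul_unfoldingPoly_eq {θ : Derivation ℂ (Base k) (Base k)}
    (hθ : derivUnfolding m θ ∈ ksIdeal f₀ m) : ∃ g : RelMilnorAlgebra f₀ m,
      ∑ j, θ (X j) • relClass f₀ m (monomial (m j) 1) = g * relClass f₀ m (unfoldingPoly f₀ m) := by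
  obtain ⟨_, hg, q, hq, hgq⟩ := Submodule.mem_sup.1 hθ
  obtain ⟨g, rfl⟩ := Ideal.mem_span_singleton'.1 hg
  refine ⟨Ideal.Quotient.mk _ g, ?_⟩
  calc ∑ j, θ (X j) • relClass f₀ m (monomial (m j) 1)
      = Ideal.Quotient.mkₐ (Base k) (relJacobian f₀ m) (derivUnfolding m θ) := by
        change _ = Ideal.Quotient.mkₐ (Base k) (relJacobian f₀ m)
          (∑ j, θ (X j) • upperMonomial m j)
        rw [map_sum]
        simp only [map_smul]
        rfl
    _ = Ideal.Quotient.mk (relJacobian f₀ m) (g * unfolding f₀ m) := by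
        rw [Ideal.Quotient.mkₐ_eq_mk, ← hgq, map_add,
          Ideal.Quotient.eq_zero_iff_mem.2 (smallJacobian_le f₀ m hq), add_zero]
    _ = Ideal.Quotient.mk _ g * relClass f₀ m (unfoldingPoly f₀ m) := map_mul _ _ _

namespace IsDualBasis

variable [DecidableEq B] {ψ : RelMilnorAlgebra f₀ m →ₗ[Base k] Base k} {δ : ℤ}
  {N : B → MvPolynomial (Fin n) (Base k)}

theorem exists_mul_unfoldingPoly_eq_sum (E : IsDualBasis w d ψ δ N)
    (D : IsUpperUnfolding w d f₀ B m M) (g : RelMilnorAlgebra f₀ m) :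
    ∃ c : Fin k → Base k, g * relClass f₀ m (unfoldingPoly f₀ m) =
      ∑ j, (∑ i, c i * coeffMatrix D ψ N i j) • relClass f₀ m (monomial (m j) 1) := by
  have : Fintype B := D.finite.fintype
  set c : B → Base k := fun β => ψ (g * relClass f₀ m (monomial β.1 1))
  refine ⟨fun i => c (D.index i.rev), ?_⟩
  calc g * relClass f₀ m (unfoldingPoly f₀ m)
      = ∑ β : B, c β • (relClass f₀ m (N β) * relClass f₀ m (unfoldingPoly f₀ m)) := by
        conv_lhs => rw [E.eq_sum_dual D g, Finset.sum_mul]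
        simp only [smul_mul_assoc, c]
    _ = ∑ i : Fin k, c (D.index i.rev) •
          (relClass f₀ m (N (D.index i.rev)) * relClass f₀ m (unfoldingPoly f₀ m)) := by
        refine (Fintype.sum_of_injective (fun i : Fin k => D.index i.rev)
          (D.index_injective.comp Fin.rev_injective) _ _ (fun β hβ => ?_) fun i => rfl).symm
        rw [E.mul_unfoldingPoly_eq_zero D, smul_zero]
        rintro ⟨j, rfl⟩
        exact hβ ⟨j.rev, congrArg D.index (Fin.rev_rev j)⟩
    _ = ∑ j, (∑ i, c (D.index i.rev) * coeffMatrix D ψ N i j) •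
          relClass f₀ m (monomial (m j) 1) := by
        simp only [E.mul_unfoldingPoly_eq D, Finset.smul_sum, smul_smul, Finset.sum_smul]
        exact Finset.sum_comm

theorem ker_kodairaSpencer_le (E : IsDualBasis w d ψ δ N) (D : IsUpperUnfolding w d f₀ B m M)
    (hm : ∀ j, m j ≠ 0) : LinearMap.ker (kodairaSpencer f₀ m hm) ≤ Submodule.span (Base k)
      (Set.range fun i => vectorField (coeffMatrix D ψ N i)) := by
  intro θ hθ
  obtain ⟨g, hg⟩ := exists_mul_unfoldingPoly_eq ((mem_ker_kodairaSpencer hm θ).1 hθ)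
  obtain ⟨c, hc⟩ := E.exists_mul_unfoldingPoly_eq_sum D g
  rw [derivation_eq_sum_smul_vectorField fun j => congrFun (D.eq_of_sum_smul_eq (hg.trans hc)) j]
  exact Submodule.sum_smul_mem _ _ fun i _ => Submodule.subset_span ⟨i, rfl⟩

theorem vectorField_coeffMatrix_mem_ker (E : IsDualBasis w d ψ δ N)
    (D : IsUpperUnfolding w d f₀ B m M) (hm : ∀ j, m j ≠ 0) (i : Fin k) :
    vectorField (coeffMatrix D ψ N i) ∈ LinearMap.ker (kodairaSpencer f₀ m hm) := by
  rw [mem_ker_kodairaSpencer, derivUnfolding_vectorField, ← sub_sub_cancel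
    (polyToRel n k (N (D.index i.rev)) * unfolding f₀ m) (∑ j, _)]
  exact Ideal.sub_mem _ (Ideal.mem_sup_left (Ideal.mul_mem_left _ _
    (Ideal.mem_span_singleton_self _))) (Ideal.mem_sup_right (E.mul_unfoldingPoly_sub_mem D i))

theorem ker_kodairaSpencer (E : IsDualBasis w d ψ δ N) (D : IsUpperUnfolding w d f₀ B m M)
    (hm : ∀ j, m j ≠ 0) : LinearMap.ker (kodairaSpencer f₀ m hm) = Submodule.span (Base k)
      (Set.range fun i => vectorField (coeffMatrix D ψ N i)) := by
  refine le_antisymm (E.ker_kodairaSpencer_le D hm) (Submodule.span_le.2 ?_)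
  rintro _ ⟨i, rfl⟩
  exact E.vectorField_coeffMatrix_mem_ker D hm i

theorem isCoeffMatrix_iff (E : IsDualBasis w d ψ δ N) (D : IsUpperUnfolding w d f₀ B m M)
    {h : Fin k → Fin k → Base k} :
    IsCoeffMatrix f₀ m (fun i => polyToRel n k (N (D.index i.rev))) h ↔
      h = coeffMatrix D ψ N := by
  have hclass : IsCoeffMatrix f₀ m (fun i => polyToRel n k (N (D.index i.rev))) h ↔
      ∀ i, relClass f₀ m (N (D.index i.rev)) * relClass f₀ m (unfoldingPoly f₀ m) =
        ∑ j, h i j • relClass f₀ m (monomial (m j) 1) := Iff.rfl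
  rw [hclass]
  refine ⟨fun hh => funext fun i => ?_, ?_⟩
  · exact D.eq_of_sum_smul_eq ((hh i).symm.trans (E.mul_unfoldingPoly_eq D i))
  · rintro rfl
    exact E.mul_unfoldingPoly_eq D

theorem polyToRel_ne_zero (E : IsDualBasis w d ψ δ N) (β : B) : polyToRel n k (N β) ≠ 0 := by
  intro h
  have hdual := E.apply_mul β β
  rw [relClass_apply, h, map_zero, zero_mul, map_zero, if_pos rfl] at hdual
  exact zero_ne_one hdual

end IsDualBasis

end Kernel

end SemiQH

end

theorem proposition3p2 {n k : ℕ} (w : Fin n → ℕ) (hw : ∀ i, 0 < w i) (d : ℕ)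
    (f₀ : MvPolynomial (Fin n) ℂ) (hf₀ : MvPolynomial.IsWeightedHomogeneous w f₀ d)
    (hsing : HasIsolatedSingularity f₀)
    (B : Set (Fin n →₀ ℕ)) (hB : IsMonomialBasis f₀ B)
    (m : Fin k → (Fin n →₀ ℕ)) (hm : EnumeratesUpper w d B m) :
    ∃ (N : Fin k → RelSeries n k) (e : Fin k → ℤ),
      (∀ i, N i ≠ 0 ∧ IsHomogeneousSeries w (tWeight w d m) (N i) (e i)) ∧
      (∃! h : Fin k → Fin k → Base k, IsCoeffMatrix f₀ m N h) ∧
      ∀ h : Fin k → Fin k → Base k, IsCoeffMatrix f₀ m N h →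
        (∀ i j, h i j = h j.rev i.rev) ∧
        (∀ i, IsHomogeneousField (tWeight w d m) (vectorField (h i)) (e i)) ∧
        LinearMap.ker (kodairaSpencer f₀ m hm.ne_zero) =
          Submodule.span (Base k) (Set.range fun i => vectorField (h i)) := by
  classical
  rcases isEmpty_or_nonempty (Fin k) with hk | ⟨⟨j₀⟩⟩
  · have : Subsingleton (Derivation ℂ (Base k) (Base k)) :=
      ⟨fun θ θ' => MvPolynomial.derivation_ext isEmptyElim⟩
    exact ⟨isEmptyElim, isEmptyElim, isEmptyElim, ⟨isEmptyElim, isEmptyElim, fun h _ =>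
      Subsingleton.elim _ _⟩, fun h _ => ⟨isEmptyElim, isEmptyElim, Subsingleton.elim _ _⟩⟩
  obtain ⟨i₀, -⟩ := Finsupp.ne_iff.1 (hm.ne_zero j₀)
  have : Nonempty (Fin n) := ⟨i₀⟩
  obtain ⟨M, hpow⟩ := hsing.exists_X_pow_mem_polyJacobian hw hf₀
  have D : IsUpperUnfolding w d f₀ B m M :=
    ⟨hw, hsing.degree_ne_zero hw hf₀, hf₀, hB, hm, hpow⟩
  obtain ⟨ψ, δ, N, E⟩ := D.exists_isDualBasis
  refine ⟨fun i => polyToRel n k (N (D.index i.rev)), fun i => δ - Finsupp.weight w (m i.rev),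
    fun i => ⟨E.polyToRel_ne_zero _, (E.isJointlyHomogeneous _).isHomogeneousSeries⟩,
    ⟨coeffMatrix D ψ N, E.isCoeffMatrix_iff D |>.2 rfl, fun h => (E.isCoeffMatrix_iff D).1⟩,
    fun h hh => ?_⟩
  rw [(E.isCoeffMatrix_iff D).1 hh]
  exact ⟨coeffMatrix_symm D ψ N, fun i =>
    isHomogeneousField_vectorField (E.isWeightedHomogeneous_coeffMatrix D i),
    E.ker_kodairaSpencer D _⟩
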